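/- Let $\alpha\in(0,1]$, let $(m_n)_{n\ge1}$ be integers with $0\le m_n\le n$ and $m_n/n\to\alpha$ (that is, $m=\alpha n$ up to rounding and lower-order terms, e.g. $m_n=\lfloor\alpha n\rfloor$), and let $\rho_n\in(0,1)$ be an arbitrary sequence. For a dimension $d\ge 1$ and $\rho\in(0,1)$ let $P_{X,Y}=P^{(d,\rho)}_{X,Y}$ be the law of a pair $(X,Y)\in\mathbb R^d\times\mathbb R^d$ whose $d$ coordinate pairs $(X_j,Y_j)$ are i.i.d. $\mathcal N\!\left(\begin{pmatrix}0\\0\end{pmatrix},\begin{pmatrix}1&\rho\\ \rho&1\end{pmatrix}\right)$, with marginals $P_X,P_Y$. One observes $(X_i)_{i=1}^n$ and $(Y_i)_{i=1}^m$, where $m=m_n$ and $P_{X,Y}$ has parameter $\rho=\rho_n$. Under $\mathcal H_0$ the data have law $P_X^{\otimes n}\otimes P_Y^{\otimes m}$. Under $\mathcal H_1$, an injection $\pi:[m]\to[n]$ is drawn uniformly at random and, conditionally on $\pi$, the pairs $(X_{\pi(i)},Y_i)$, $i\in[m]$, are i.i.d. with law $P_{X,Y}$, while the remaining $X_j$,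 $j\in[n]\setminus\pi([m])$, are i.i.d. with law $P_X$ and independent of these pairs. Strong detection is possible if there is a sequence of tests of $\mathcal H_0$ against $\mathcal H_1$ whose type-I and type-II error probabilities both tend to $0$ as $n\to\infty$. Then: 1. (Fixed dimension.) For every fixed $d\ge1$, strong detection is possible if and only if $\rho_n^2=1-o(1)$, i.e. $\rho_n^2\to1$ as $n\to\infty$. 2. (Growing dimension.) For every sequence of dimensions $d=d_n\to\infty$, strong detection is possible if and only if $\rho_n^2d_n=\omega(1)$, i.e. $\rho_n^2d_n\to\infty$ as $n\to\infty$. -/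

import Mathlib

open MeasureTheory ProbabilityTheory Filter Topology

namespace BrokenSample

noncomputable section

/-- The data space: the samples `X₁, …, Xₙ` in `𝒳` together with `Y₁, …, Yₘ` in `𝒴`. -/
abbrev Data (𝒳 𝒴 : Type*) (n m : ℕ) : Type _ := (Fin n → 𝒳) × (Fin m → 𝒴)

section Model

variable {𝒳 𝒴 : Type*} [MeasurableSpace 𝒳] [MeasurableSpace 𝒴]

/-- The law of the data under the null hypothesis: `P_X^{⊗ n} ⊗ P_Y^{⊗ m}`, where `P_X = P.fst`
and `P_Y = P.snd` are the marginals of the joint law `P` of a pair. -/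
def nullLaw (P : Measure (𝒳 × 𝒴)) (n m : ℕ) : Measure (Data 𝒳 𝒴 n m) :=
  (Measure.pi fun _ : Fin n => P.fst).prod (Measure.pi fun _ : Fin m => P.snd)

/-- Assembles the data from the matched pairs `z₁, …, zₘ` and the fresh points `x₁, …, xₙ`:
`X_{π(i)}` and `Yᵢ` are the two components of `zᵢ`, and `X_j = x_j` for `j` outside the range
of `π` (the points `x_{π(i)}` are not used). -/
def assemble {n m : ℕ} (π : Fin m ↪ Fin n) (w : (Fin m → 𝒳 × 𝒴) × (Fin n → 𝒳)) :
    Data 𝒳 𝒴 n m :=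
  (Function.extend π (fun i => (w.1 i).1) w.2, fun i => (w.1 i).2)

/-- The law of the data under the alternative hypothesis, conditional on the injection `π`: the
pairs `(X_{π(i)}, Yᵢ)` are i.i.d. with law `P`, and the remaining `X_j` are i.i.d. with law `P_X`
and independent of these pairs. -/
def plantedLawGiven (P : Measure (𝒳 × 𝒴)) {n m : ℕ} (π : Fin m ↪ Fin n) :
    Measure (Data 𝒳 𝒴 n m) :=
  ((Measure.pi fun _ : Fin m => P).prod (Measure.pi fun _ : Fin n => P.fst)).map (assemble π)

/-- The law of the data under the alternative hypothesis: the mixture of the conditional laws over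
a uniformly random injection `π : [m] → [n]` (used for `m ≤ n`). -/
def plantedLaw (P : Measure (𝒳 × 𝒴)) (n m : ℕ) : Measure (Data 𝒳 𝒴 n m) :=
  (Fintype.card (Fin m ↪ Fin n) : ENNReal)⁻¹ • ∑ π : Fin m ↪ Fin n, plantedLawGiven P π

end Model

/-- Strong detection is possible for the sequence of testing problems `P₀ n` versus `P₁ n`: some
sequence of tests, given by rejection regions `A n`, has vanishing type I error `P₀ n (A n)` and
vanishing type II error `P₁ n (A n)ᶜ`. -/
def StrongDetection {Ω : ℕ → Type*} [∀ n, MeasurableSpace (Ω n)]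
    (P₀ P₁ : ∀ n, Measure (Ω n)) : Prop :=
  ∃ A : ∀ n, Set (Ω n), (∀ n, MeasurableSet (A n)) ∧
    Tendsto (fun n => P₀ n (A n)) atTop (𝓝 0) ∧
    Tendsto (fun n => P₁ n (A n)ᶜ) atTop (𝓝 0)

/-- The joint law on `ℝᵈ × ℝᵈ` of a pair `(X, Y)` in the Gaussian model: the `d` coordinate pairs
`(X_j, Y_j)` are i.i.d. bivariate normal with mean `0`, unit variances and correlation `ρ`. -/
def gaussianPair (d : ℕ) (ρ : ℝ) : Measure ((Fin d → ℝ) × (Fin d → ℝ)) :=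
  (Measure.pi fun _ : Fin d =>
    multivariateGaussian (0 : EuclideanSpace ℝ (Fin 2)) !![1, ρ; ρ, 1]).map
      fun w => (fun j => w j 0, fun j => w j 1)

end

end BrokenSample

/-! Impossibility comes from a second moment bound that is uniform in `n`. The likelihood ratio `L`
of the planted law is an average, over injections, of products of Mehler kernels. Integrating out
the `Y`'s in `E L²` turns a pair of injections into a product of kernels with parameter `ρ²`; by
symmetry one injection may be fixed and the other averaged over a uniform permutation of `[n]`.
Indices outside the range of the fixed injection receive parameter `0`, whose kernel is identically
`1`, so `E L²` is `permTrace / n!`. By the semigroup property a cycle of the permutation contributes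
the trace of the product of its parameters, and the trace at `t` is `(1 - t)⁻ᵈ`. Peeling off a point
gives a recursion (`permTrace_succ`), which `permTrace_le` compares with the coefficients of `(1 -
z)⁻¹ (1 - r z)^(-S/r)`. Here `r` bounds `ρ²` and `S` bounds `(1 - ρ²)⁻ᵈ - 1`. For `r < 1` these
coefficients are bounded, so strong detection fails whenever `r` and `S` can be kept fixed along
infinitely many `n` (`not_strongDetection_of_frequently`). This happens for fixed `d` unless `ρ² →
1`, and for `d → ∞` unless `ρ² d → ∞`. Possibility comes from thresholding `crossSum g`, the sum of
a kernel `g` over all pairs `(X_j, Y_i)`. When `g` is centered in each variable, distinct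
off-diagonal terms are almost all uncorrelated, so the noise has variance of order `n m E₀ g²`,
against a planted mean `m E g`. Chebyshev's inequality (`IsDegenerateKernel.exists_test`) then
requires `(n / m) E₀ g² / (E g)²` to be small, and `n / m` stays bounded because `α > 0`. For
growing dimension `g` is the inner product, and the ratio is of order `1 / (ρ² d)`. For fixed
dimension `g` is a centered projection kernel onto `K` bins of one coordinate: as `ρ → 1` its mean
is of order `K` while its null second moment is at most of order `K`, so the ratio is of order `1 /
K`, with `K` arbitrary. -/

namespace BrokenSample

/-! ### Product measures, the planted law and its likelihood ratio. -/

section ProductMeasures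

variable {𝒳 𝒴 : Type*} [MeasurableSpace 𝒳] [MeasurableSpace 𝒴]

theorem lintegral_pi_succ {n : ℕ} (μ : Measure 𝒳) [SigmaFinite μ] {F : (Fin (n + 1) → 𝒳) → ENNReal}
    (hF : Measurable F) :
    ∫⁻ x, F x ∂(Measure.pi fun _ : Fin (n + 1) => μ) =
      ∫⁻ x, ∫⁻ a, F (Fin.cons a x) ∂μ ∂(Measure.pi fun _ : Fin n => μ) := by
  have h := (measurePreserving_piFinSuccAbove (fun _ : Fin (n + 1) => μ) 0).symm
  rw [← h.lintegral_comp hF]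
  refine (lintegral_prod_symm' (μ := μ) (ν := Measure.pi fun _ : Fin n => μ)
    (fun z => F ((MeasurableEquiv.piFinSuccAbove _ 0).symm z))
    (hF.comp (MeasurableEquiv.measurable _))).trans
    (lintegral_congr fun x => lintegral_congr fun a => ?_)
  congr 1
  simp [MeasurableEquiv.piFinSuccAbove, Fin.consEquiv]

theorem lintegral_pi_prod {n : ℕ} (μ : Measure 𝒳) [SigmaFinite μ] {f : Fin n → 𝒳 → ENNReal}
    (hf : ∀ i, Measurable (f i)) :
    ∫⁻ x, ∏ i, f i (x i) ∂(Measure.pi fun _ : Fin n => μ) = ∏ i, ∫⁻ a, f i a ∂μ := by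
  induction n with
  | zero => simp
  | succ n ih =>
    rw [lintegral_pi_succ μ (by fun_prop), Fin.prod_univ_succ]
    simp only [Fin.prod_univ_succ, Fin.cons_zero, Fin.cons_succ]
    rw [← ih fun i => hf i.succ, ← lintegral_const_mul _ (by fun_prop)]
    refine lintegral_congr fun x => ?_
    rw [lintegral_mul_const _ (hf 0)]

theorem data_measure_ext {n m : ℕ} {μ ν : Measure (Data 𝒳 𝒴 n m)} [IsFiniteMeasure μ]
    (huniv : μ Set.univ = ν Set.univ)
    (h : ∀ (S : Fin n → Set 𝒳) (T : Fin m → Set 𝒴), (∀ j, MeasurableSet (S j)) →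
      (∀ i, MeasurableSet (T i)) →
      μ (Set.univ.pi S ×ˢ Set.univ.pi T) = ν (Set.univ.pi S ×ˢ Set.univ.pi T)) : μ = ν := by
  refine ext_of_generate_finite _
    (generateFrom_eq_prod generateFrom_pi generateFrom_pi
      ?_ ?_).symm (isPiSystem_pi.prod isPiSystem_pi) ?_ huniv
  · exact ⟨fun _ => Set.univ,
      fun _ => ⟨fun _ => Set.univ, by simp [Set.mem_pi]⟩, by simp [Set.iUnion_const]⟩
  · exact ⟨fun _ => Set.univ,
      fun _ => ⟨fun _ => Set.univ, by simp [Set.mem_pi]⟩, by simp [Set.iUnion_const]⟩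
  · rintro _ ⟨_, ⟨S, hS, rfl⟩, _, ⟨T, hT, rfl⟩, rfl⟩
    exact h S T (fun j => hS j trivial) fun i => hT i trivial

/-- Reads off the data from `n` pairs: all first components, and the second components of the
pairs with index `π i`. -/
def unzipAlong {n m : ℕ} (π : Fin m ↪ Fin n) (z : Fin n → 𝒳 × 𝒴) : Data 𝒳 𝒴 n m :=
  (fun j => (z j).1, fun i => (z (π i)).2)

@[fun_prop]
theorem measurable_unzipAlong {n m : ℕ} (π : Fin m ↪ Fin n) :
    Measurable (unzipAlong π : (Fin n → 𝒳 × 𝒴) → Data 𝒳 𝒴 n m) := by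
  unfold unzipAlong; fun_prop

@[fun_prop]
theorem measurable_assemble {n m : ℕ} (π : Fin m ↪ Fin n) :
    Measurable (assemble π : (Fin m → 𝒳 × 𝒴) × (Fin n → 𝒳) → Data 𝒳 𝒴 n m) := by
  unfold assemble
  refine Measurable.prodMk (measurable_pi_lambda _ fun j => ?_) (by fun_prop)
  by_cases h : ∃ i, π i = j
  · obtain ⟨i, rfl⟩ := h
    simp only [π.injective.extend_apply]
    fun_prop
  · simp only [Function.extend_apply' _ _ _ h]
    fun_prop

/-- Padding with units lets products over the matched indices be compared factor by factor with
products over all of `[n]`. -/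
theorem prod_extend {n m : ℕ} {M : Type*} [CommMonoid M] (π : Fin m ↪ Fin n) (f : Fin m → M) :
    ∏ j, Function.extend π f (fun _ => 1) j = ∏ i, f i := by
  classical
  rw [← Finset.prod_mul_prod_compl (Finset.univ.map π), Finset.prod_map]
  rw [Finset.prod_eq_one (s := (Finset.univ.map π)ᶜ), mul_one]
  · simp [π.injective.extend_apply]
  · intro j hj
    exact Function.extend_apply' _ _ _ (by simpa using hj)

theorem measurableSet_extend {n m : ℕ} (π : Fin m ↪ Fin n) {T : Fin m → Set 𝒴}
    (hT : ∀ i, MeasurableSet (T i)) (j : Fin n) :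
    MeasurableSet (Function.extend π T (fun _ => Set.univ) j) := by
  by_cases h : ∃ i, π i = j
  · obtain ⟨i, rfl⟩ := h
    simpa only [π.injective.extend_apply] using hT i
  · simp only [Function.extend_apply' _ _ _ h, MeasurableSet.univ]

theorem map_unzipAlong_rect {n m : ℕ} (π : Fin m ↪ Fin n) (P : Measure (𝒳 × 𝒴)) [SigmaFinite P]
    {S : Fin n → Set 𝒳} {T : Fin m → Set 𝒴} (hS : ∀ j, MeasurableSet (S j))
    (hT : ∀ i, MeasurableSet (T i)) :
    (Measure.pi fun _ => P).map (unzipAlong π) (Set.univ.pi S ×ˢ Set.univ.pi T) =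
      ∏ j, P (S j ×ˢ Function.extend π T (fun _ => Set.univ) j) := by
  rw [Measure.map_apply (by fun_prop) ((MeasurableSet.univ_pi hS).prod (MeasurableSet.univ_pi hT)),
    ← Measure.pi_pi]
  congr 1
  ext z
  simp only [unzipAlong, Set.mem_preimage, Set.mem_prod, Set.mem_pi, Set.mem_univ, true_implies,
    forall_and]
  refine and_congr_right fun _ => ⟨fun h j => ?_, fun h i => ?_⟩
  · by_cases hj : ∃ i, π i = j
    · obtain ⟨i, rfl⟩ := hj
      simpa only [π.injective.extend_apply] using h i
    · simp only [Function.extend_apply' _ _ _ hj, Set.mem_univ]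
  · simpa only [π.injective.extend_apply] using h (π i)

/-- An unmatched `X_j` may be given a partner that is then forgotten. This realizes the planted law
on `n` i.i.d. pairs, where independence is easiest to use. Both laws are compared on boxes. -/
theorem plantedLawGiven_eq_map {n m : ℕ} (π : Fin m ↪ Fin n) (P : Measure (𝒳 × 𝒴))
    [IsProbabilityMeasure P] :
    plantedLawGiven P π = (Measure.pi fun _ => P).map (unzipAlong π) := by
  classical
  unfold plantedLawGiven
  have := Measure.isProbabilityMeasure_map (μ := (Measure.pi fun _ : Fin m => P).prod
    (Measure.pi fun _ : Fin n => P.fst)) (measurable_assemble π).aemeasurable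
  have := Measure.isProbabilityMeasure_map (μ := Measure.pi fun _ : Fin n => P)
    (measurable_unzipAlong π).aemeasurable
  refine data_measure_ext (by simp) fun S T hS hT => ?_
  rw [map_unzipAlong_rect π P hS hT, Measure.map_apply (by fun_prop)
    ((MeasurableSet.univ_pi hS).prod (MeasurableSet.univ_pi hT))]
  -- A fresh point with index in the range of `π` is overwritten, so it is unconstrained and
  -- contributes a factor `1`.
  have : assemble π ⁻¹' (Set.univ.pi S ×ˢ Set.univ.pi T) =
      (Set.univ.pi fun i => S (π i) ×ˢ T i) ×ˢ
        (Set.univ.pi fun j => if j ∈ Finset.univ.map π then Set.univ else S j) := by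
    ext w
    simp only [assemble, Set.mem_preimage, Set.mem_prod, Set.mem_pi, Set.mem_univ, true_implies,
      forall_and]
    constructor
    · rintro ⟨h1, h2⟩
      refine ⟨⟨fun i => ?_, h2⟩, fun j => ?_⟩
      · simpa only [π.injective.extend_apply] using h1 (π i)
      · split_ifs with hj
        · trivial
        · have := h1 j
          rwa [Function.extend_apply' _ _ _ (by simpa using hj)] at this
    · rintro ⟨⟨h1, h2⟩, h3⟩
      refine ⟨fun j => ?_, h2⟩
      by_cases hj : ∃ i, π i = j
      · obtain ⟨i, rfl⟩ := hj
        simpa only [π.injective.extend_apply] using h1 i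
      · rw [Function.extend_apply' _ _ _ hj]
        have := h3 j
        rwa [if_neg (by simpa using hj)] at this
  rw [this, Measure.prod_prod, Measure.pi_pi, Measure.pi_pi,
    ← Finset.prod_mul_prod_compl (Finset.univ.map π) fun j =>
      P (S j ×ˢ Function.extend π T (fun _ => Set.univ) j), Finset.prod_map,
    ← Finset.prod_mul_prod_compl (Finset.univ.map π) fun j =>
      P.fst (if j ∈ Finset.univ.map π then Set.univ else S j)]
  rw [Finset.prod_eq_one (s := Finset.univ.map π) fun j hj => by rw [if_pos hj, measure_univ], one_mul]
  congr 1
  · simp only [π.injective.extend_apply]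
  · refine Finset.prod_congr rfl fun j hj => ?_
    rw [Finset.mem_compl] at hj
    rw [if_neg hj, Function.extend_apply' _ _ _ (by simpa using hj), Measure.fst_apply (hS j),
      ← Set.prod_univ]

theorem nullLaw_rect {n m : ℕ} (P : Measure (𝒳 × 𝒴)) [IsProbabilityMeasure P]
    (S : Fin n → Set 𝒳) (T : Fin m → Set 𝒴) :
    nullLaw P n m (Set.univ.pi S ×ˢ Set.univ.pi T) = (∏ j, P.fst (S j)) * ∏ i, P.snd (T i) := by
  rw [nullLaw, Measure.prod_prod, Measure.pi_pi, Measure.pi_pi]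

instance (P : Measure (𝒳 × 𝒴)) [IsProbabilityMeasure P] (n m : ℕ) :
    IsProbabilityMeasure (nullLaw P n m) := by
  unfold nullLaw; infer_instance

instance {n m : ℕ} (π : Fin m ↪ Fin n) (P : Measure (𝒳 × 𝒴)) [IsProbabilityMeasure P] :
    IsProbabilityMeasure (plantedLawGiven P π) :=
  Measure.isProbabilityMeasure_map (measurable_assemble π).aemeasurable

/-- With independent partners the matching is invisible. Estimates proved for planted laws therefore
apply to the null law as well. -/
theorem nullLaw_eq_plantedLawGiven {n m : ℕ} (π : Fin m ↪ Fin n) (P : Measure (𝒳 × 𝒴))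
    [IsProbabilityMeasure P] :
    nullLaw P n m = plantedLawGiven (P.fst.prod P.snd) π := by
  refine data_measure_ext (by simp) fun S T hS hT => ?_
  rw [nullLaw_rect, plantedLawGiven_eq_map, map_unzipAlong_rect _ _ hS hT]
  simp only [Measure.prod_prod, Finset.prod_mul_distrib]
  congr 1
  rw [← prod_extend π]
  refine Finset.prod_congr rfl fun j _ => ?_
  by_cases hj : ∃ i, π i = j
  · obtain ⟨i, rfl⟩ := hj
    simp only [π.injective.extend_apply]
  · simp only [Function.extend_apply' _ _ _ hj, measure_univ]

/-- The likelihood ratio of the planted law, given `π`, with respect to the null law. -/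
noncomputable def likelihood {n m : ℕ} (ℓ : 𝒳 → 𝒴 → ENNReal) (π : Fin m ↪ Fin n) (w : Data 𝒳 𝒴 n m) : ENNReal :=
  ∏ i, ℓ (w.1 (π i)) (w.2 i)

@[fun_prop]
theorem measurable_likelihood {n m : ℕ} {ℓ : 𝒳 → 𝒴 → ENNReal} (hℓ : Measurable (Function.uncurry ℓ))
    (π : Fin m ↪ Fin n) : Measurable (likelihood ℓ π) := by
  unfold likelihood
  refine Finset.measurable_prod _ fun i _ => ?_
  exact hℓ.comp (f := fun w : Data 𝒳 𝒴 n m => (w.1 (π i), w.2 i)) (by fun_prop)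

theorem plantedLawGiven_eq_withDensity {n m : ℕ} (π : Fin m ↪ Fin n) (P : Measure (𝒳 × 𝒴))
    [IsProbabilityMeasure P] {ℓ : 𝒳 → 𝒴 → ENNReal} (hℓ : Measurable (Function.uncurry ℓ))
    (hP : P = (P.fst.prod P.snd).withDensity (Function.uncurry ℓ))
    (h1 : ∀ x, ∫⁻ y, ℓ x y ∂P.snd = 1) :
    plantedLawGiven P π = (nullLaw P n m).withDensity (likelihood ℓ π) := by
  have key : ∀ (S : Fin n → Set 𝒳) (T : Fin m → Set 𝒴), (∀ j, MeasurableSet (S j)) →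
      (∀ i, MeasurableSet (T i)) → plantedLawGiven P π (Set.univ.pi S ×ˢ Set.univ.pi T) =
        (nullLaw P n m).withDensity (likelihood ℓ π) (Set.univ.pi S ×ˢ Set.univ.pi T) := by
    intro S T hS hT
    have hrect := (MeasurableSet.univ_pi hS).prod (MeasurableSet.univ_pi hT)
    rw [plantedLawGiven_eq_map, map_unzipAlong_rect _ _ hS hT, withDensity_apply _ hrect, nullLaw,
      ← lintegral_indicator hrect, lintegral_prod _
        ((measurable_likelihood hℓ π).indicator hrect).aemeasurable]
    have hint : ∀ x : Fin n → 𝒳, ∫⁻ y, (Set.univ.pi S ×ˢ Set.univ.pi T).indicator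
        (likelihood ℓ π) (x, y) ∂(Measure.pi fun _ : Fin m => P.snd) =
        ∏ j, (S j).indicator (fun a => ∫⁻ y in Function.extend π T (fun _ => Set.univ) j,
          ℓ a y ∂P.snd) (x j) := by
      intro x
      have : ∀ y : Fin m → 𝒴, (Set.univ.pi S ×ˢ Set.univ.pi T).indicator
          (likelihood ℓ π) (x, y) = (∏ j, (S j).indicator (fun _ => 1) (x j)) *
            ∏ i, (T i).indicator (ℓ (x (π i))) (y i) := by
        intro y
        by_cases hx : ∀ j, x j ∈ S j
        · by_cases hy : ∀ i, y i ∈ T i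
          · rw [Set.indicator_of_mem (by simp [Set.mem_pi, hx, hy])]
            simp [hx, hy, likelihood]
          · rw [Set.indicator_of_notMem (by simp only [Set.mem_prod, Set.mem_pi]; tauto)]
            push Not at hy
            obtain ⟨i, hi⟩ := hy
            rw [Finset.prod_eq_zero (Finset.mem_univ i) (Set.indicator_of_notMem hi _), mul_zero]
        · rw [Set.indicator_of_notMem (by simp only [Set.mem_prod, Set.mem_pi]; tauto)]
          push Not at hx
          obtain ⟨j, hj⟩ := hx
          rw [Finset.prod_eq_zero (Finset.mem_univ j) (Set.indicator_of_notMem hj _), zero_mul]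
      simp_rw [this]
      have hm : ∀ i, Measurable ((T i).indicator (ℓ (x (π i)))) := fun i =>
        (hℓ.comp measurable_prodMk_left).indicator (hT i)
      rw [lintegral_const_mul _ (by fun_prop), lintegral_pi_prod _ hm, ← prod_extend π,
        ← Finset.prod_mul_distrib]
      refine Finset.prod_congr rfl fun j _ => ?_
      by_cases hj : ∃ i, π i = j
      · obtain ⟨i, rfl⟩ := hj
        simp only [π.injective.extend_apply]
        rw [lintegral_indicator (hT i)]
        by_cases hx : x (π i) ∈ S (π i) <;> simp [hx]
      -- At an unmatched index the second set is everything, and `h1` makes the density integrate to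
      -- `1`.
      · simp only [Function.extend_apply' _ _ _ hj, mul_one]
        by_cases hx : x j ∈ S j <;> simp [hx, h1]
    simp_rw [hint]
    have hE := measurableSet_extend π hT
    rw [lintegral_pi_prod]
    · refine Finset.prod_congr rfl fun j _ => ?_
      rw [lintegral_indicator (hS j)]
      conv_lhs => rw [hP]
      rw [withDensity_apply _ ((hS j).prod (hE j)), ← Measure.prod_restrict,
        lintegral_prod _ hℓ.aemeasurable]
      rfl
    · exact fun j => (Measurable.lintegral_prod_right' hℓ).indicator (hS j)
  have huniv := key (fun _ => Set.univ) (fun _ => Set.univ) (by simp) (by simp)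
  simp only [Set.pi_univ, Set.univ_prod_univ] at huniv
  exact data_measure_ext huniv key

/-- The likelihood ratio of the planted law with respect to the null law. -/
noncomputable def mixedLikelihood (ℓ : 𝒳 → 𝒴 → ENNReal) (n m : ℕ) (w : Data 𝒳 𝒴 n m) : ENNReal :=
  (Fintype.card (Fin m ↪ Fin n) : ENNReal)⁻¹ * ∑ π : Fin m ↪ Fin n, likelihood ℓ π w

theorem plantedLaw_eq_withDensity {n m : ℕ} (P : Measure (𝒳 × 𝒴))
    [IsProbabilityMeasure P] {ℓ : 𝒳 → 𝒴 → ENNReal} (hℓ : Measurable (Function.uncurry ℓ))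
    (hP : P = (P.fst.prod P.snd).withDensity (Function.uncurry ℓ))
    (h1 : ∀ x, ∫⁻ y, ℓ x y ∂P.snd = 1) :
    plantedLaw P n m = (nullLaw P n m).withDensity (mixedLikelihood ℓ n m) := by
  ext A hA
  rw [plantedLaw, withDensity_apply _ hA, Measure.smul_apply, Measure.finsetSum_apply]
  unfold mixedLikelihood
  rw [lintegral_const_mul _ (Finset.measurable_sum _ fun π _ => measurable_likelihood hℓ π),
    lintegral_finsetSum _ fun π _ => measurable_likelihood hℓ π, smul_eq_mul]
  congr 1
  refine Finset.sum_congr rfl fun π _ => ?_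
  rw [plantedLawGiven_eq_withDensity π P hℓ hP h1, withDensity_apply _ hA]

theorem isProbabilityMeasure_plantedLaw {n m : ℕ} (h : m ≤ n) (P : Measure (𝒳 × 𝒴))
    [IsProbabilityMeasure P] : IsProbabilityMeasure (plantedLaw P n m) := by
  have : Nonempty (Fin m ↪ Fin n) := ⟨Fin.castLEEmb h⟩
  constructor
  rw [plantedLaw, Measure.smul_apply, Measure.finsetSum_apply]
  simp only [measure_univ, Finset.sum_const, Finset.card_univ, nsmul_eq_mul, mul_one, smul_eq_mul]
  exact ENNReal.inv_mul_cancel (by simpa using h) (by simp)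

end ProductMeasures

/-! ### The Mehler kernel and the bivariate normal law. -/

section Mehler

/-- The density of the standard bivariate normal law with correlation `ρ` with respect to the
product of its marginals. -/
noncomputable def mehler (ρ x y : ℝ) : ENNReal :=
  ENNReal.ofReal ((√(1 - ρ ^ 2))⁻¹ *
    Real.exp (-(ρ ^ 2 * x ^ 2 + ρ ^ 2 * y ^ 2 - 2 * ρ * x * y) / (2 * (1 - ρ ^ 2))))

theorem mehler_comm (ρ x y : ℝ) : mehler ρ x y = mehler ρ y x := by
  unfold mehler; ring_nf

theorem mehler_zero (x y : ℝ) : mehler 0 x y = 1 := by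
  simp [mehler]

@[fun_prop]
theorem measurable_mehler (ρ : ℝ) : Measurable (Function.uncurry (mehler ρ)) := by
  unfold mehler Function.uncurry; fun_prop

theorem lintegral_exp_quadratic_gaussian {b : ℝ} (hb : -1 < b) (c : ℝ) :
    ∫⁻ z, ENNReal.ofReal (Real.exp (-(b * z ^ 2) / 2 + c * z)) ∂(gaussianReal 0 1) =
      ENNReal.ofReal ((√(1 + b))⁻¹ * Real.exp (c ^ 2 / (2 * (1 + b)))) := by
  have hb' : 0 < 1 + b := by linarith
  -- Completing the square: the tilted density is a constant times the normal density with mean `c /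
  -- (1 + b)` and variance `1 / (1 + b)`.
  set v : NNReal := (1 + b)⁻¹.toNNReal with hv
  have hv0 : v ≠ 0 := (Real.toNNReal_pos.2 (inv_pos.2 hb')).ne'
  rw [gaussianReal_of_var_ne_zero 0 one_ne_zero,
    lintegral_withDensity_eq_lintegral_mul _ (measurable_gaussianPDF 0 1) (by fun_prop)]
  have : ∀ z, (gaussianPDF 0 1 * fun z => ENNReal.ofReal (Real.exp (-(b * z ^ 2) / 2 + c * z))) z =
      ENNReal.ofReal ((√(1 + b))⁻¹ * Real.exp (c ^ 2 / (2 * (1 + b)))) *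
        gaussianPDF (c / (1 + b)) v z := by
    intro z
    simp only [Pi.mul_apply, gaussianPDF]
    rw [← ENNReal.ofReal_mul (gaussianPDFReal_nonneg _ _ _), ← ENNReal.ofReal_mul (by positivity)]
    congr 1
    simp only [gaussianPDFReal]
    have h1 : ((v : NNReal) : ℝ) = (1 + b)⁻¹ := Real.coe_toNNReal _ (inv_pos.2 hb').le
    have h2 : √(2 * Real.pi * ((v : NNReal) : ℝ)) = √(2 * Real.pi * ((1 : NNReal) : ℝ)) * (√(1 + b))⁻¹ := by
      rw [h1, NNReal.coe_one, mul_one, Real.sqrt_mul (by positivity), Real.sqrt_inv]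
    rw [h2, h1]
    have h3 : √(1 + b) ≠ 0 := (Real.sqrt_pos.2 hb').ne'
    rw [mul_inv, inv_inv, mul_assoc, ← Real.exp_add]
    rw [show (√(1 + b))⁻¹ * Real.exp (c ^ 2 / (2 * (1 + b))) *
      ((√(2 * Real.pi * ((1 : NNReal) : ℝ)))⁻¹ * √(1 + b) *
        Real.exp (-(z - c / (1 + b)) ^ 2 / (2 * (1 + b)⁻¹))) =
      ((√(1 + b))⁻¹ * √(1 + b)) * ((√(2 * Real.pi * ((1 : NNReal) : ℝ)))⁻¹ *
        (Real.exp (c ^ 2 / (2 * (1 + b))) *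
          Real.exp (-(z - c / (1 + b)) ^ 2 / (2 * (1 + b)⁻¹)))) by ring,
      ← Real.exp_add, inv_mul_cancel₀ h3, one_mul]
    congr 2
    simp only [NNReal.coe_one]
    field_simp
    ring
  simp_rw [this]
  rw [lintegral_const_mul _ (measurable_gaussianPDF _ _), lintegral_gaussianPDF_eq_one _ hv0,
    mul_one]

/-- Conceptually, `mehler ρ` acts on the `k`-th Hermite polynomial by `ρ ^ k`, so composition
multiplies the parameters. The proof is a direct Gaussian integral in `z`. -/
theorem lintegral_mehler_mul_mehler {s t : ℝ} (hs : s ∈ Set.Ico (0 : ℝ) 1)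
    (ht : t ∈ Set.Ico (0 : ℝ) 1) (x y : ℝ) :
    ∫⁻ z, mehler s x z * mehler t z y ∂(gaussianReal 0 1) = mehler (s * t) x y := by
  have hs2 : 0 < 1 - s ^ 2 := by nlinarith [hs.1, hs.2]
  have ht2 : 0 < 1 - t ^ 2 := by nlinarith [ht.1, ht.2]
  have hst : 0 < 1 - (s * t) ^ 2 := by
    have : s ^ 2 * t ^ 2 ≤ s ^ 2 := mul_le_of_le_one_right (sq_nonneg s) (by linarith)
    nlinarith
  have hb : 1 + (s ^ 2 / (1 - s ^ 2) + t ^ 2 / (1 - t ^ 2)) =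
      (1 - (s * t) ^ 2) / ((1 - s ^ 2) * (1 - t ^ 2)) := by
    field_simp; ring
  have hb1 : -1 < s ^ 2 / (1 - s ^ 2) + t ^ 2 / (1 - t ^ 2) := by
    have : 0 ≤ s ^ 2 / (1 - s ^ 2) + t ^ 2 / (1 - t ^ 2) := by positivity
    linarith
  set C : ℝ := (√(1 - s ^ 2))⁻¹ * (√(1 - t ^ 2))⁻¹ *
    Real.exp (-(s ^ 2 * x ^ 2 / (2 * (1 - s ^ 2))) - t ^ 2 * y ^ 2 / (2 * (1 - t ^ 2))) with hC
  have key : ∀ z, mehler s x z * mehler t z y = ENNReal.ofReal C *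
      ENNReal.ofReal (Real.exp (-((s ^ 2 / (1 - s ^ 2) + t ^ 2 / (1 - t ^ 2)) * z ^ 2) / 2 +
        (s * x / (1 - s ^ 2) + t * y / (1 - t ^ 2)) * z)) := by
    intro z
    unfold mehler
    rw [← ENNReal.ofReal_mul (by positivity), ← ENNReal.ofReal_mul (by positivity)]
    congr 1
    rw [hC, mul_mul_mul_comm, mul_assoc (_ * _) (Real.exp _) (Real.exp _), ← Real.exp_add,
      ← Real.exp_add]
    congr 2
    field_simp
    ring
  simp_rw [key]
  rw [lintegral_const_mul _ (by fun_prop), lintegral_exp_quadratic_gaussian hb1, hb,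
    ← ENNReal.ofReal_mul (by positivity)]
  unfold mehler
  congr 1
  rw [hC, Real.sqrt_div hst.le, Real.sqrt_mul hs2.le, inv_div]
  have h1 : √(1 - s ^ 2) ≠ 0 := (Real.sqrt_pos.2 hs2).ne'
  have h2 : √(1 - t ^ 2) ≠ 0 := (Real.sqrt_pos.2 ht2).ne'
  rw [show ∀ E F : ℝ, (√(1 - s ^ 2))⁻¹ * (√(1 - t ^ 2))⁻¹ * E *
      (√(1 - s ^ 2) * √(1 - t ^ 2) / √(1 - (s * t) ^ 2) * F) =
      ((√(1 - s ^ 2))⁻¹ * √(1 - s ^ 2)) * ((√(1 - t ^ 2))⁻¹ * √(1 - t ^ 2)) *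
        ((√(1 - (s * t) ^ 2))⁻¹ * (E * F)) by intros; ring, inv_mul_cancel₀ h1, inv_mul_cancel₀ h2,
    one_mul, one_mul, ← Real.exp_add]
  congr 2
  have h3 : 1 - s ^ 2 * t ^ 2 ≠ 0 := by rw [← mul_pow]; exact hst.ne'
  rw [mul_pow]
  field_simp
  ring

/-- The trace is the geometric series of the eigenvalues `t ^ k`, computed here as a Gaussian
integral. -/
theorem lintegral_mehler_self {t : ℝ} (ht : t ∈ Set.Ico (0 : ℝ) 1) :
    ∫⁻ x, mehler t x x ∂(gaussianReal 0 1) = ENNReal.ofReal (1 - t)⁻¹ := by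
  have h1 : 0 < 1 - t := by linarith [ht.2]
  have h2 : 0 < 1 + t := by linarith [ht.1]
  have h3 : (1 : ℝ) - t ^ 2 = (1 - t) * (1 + t) := by ring
  have key : ∀ x, mehler t x x = ENNReal.ofReal (√(1 - t ^ 2))⁻¹ *
      ENNReal.ofReal (Real.exp (-((-2 * t / (1 + t)) * x ^ 2) / 2 + 0 * x)) := by
    intro x
    unfold mehler
    rw [← ENNReal.ofReal_mul (by positivity)]
    congr 3
    rw [h3]
    field_simp
    ring
  have hb : 1 + (-2 * t / (1 + t)) = (1 - t) / (1 + t) := by field_simp; ring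
  simp_rw [key]
  rw [lintegral_const_mul _ (by fun_prop), lintegral_exp_quadratic_gaussian
    (by have : 0 < (1 - t) / (1 + t) := by positivity
        linarith), hb, ← ENNReal.ofReal_mul (by positivity), h3]
  congr 1
  rw [Real.sqrt_mul h1.le, Real.sqrt_div h1.le]
  have h4 : √(1 + t) ≠ 0 := (Real.sqrt_pos.2 h2).ne'
  have h5 : √(1 - t) ≠ 0 := (Real.sqrt_pos.2 h1).ne'
  have h6 : √(1 - t) * √(1 - t) = 1 - t := Real.mul_self_sqrt h1.le
  simp only [ne_eq, OfNat.ofNat_ne_zero, not_false_eq_true, zero_pow, zero_div, Real.exp_zero,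
    mul_one]
  conv_rhs => rw [← h6]
  field_simp

theorem gaussianPDF_mul_mehler {ρ : ℝ} (hρ : ρ ∈ Set.Ico (0 : ℝ) 1) (x y : ℝ) :
    gaussianPDF 0 1 y * mehler ρ x y = gaussianPDF (ρ * x) (1 - ρ ^ 2).toNNReal y := by
  have hs2 : 0 < 1 - ρ ^ 2 := by nlinarith [hρ.1, hρ.2]
  rw [gaussianPDF, gaussianPDF, mehler, ← ENNReal.ofReal_mul (gaussianPDFReal_nonneg _ _ _)]
  congr 1
  rw [gaussianPDFReal, gaussianPDFReal, NNReal.coe_one, mul_one, mul_one,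
    Real.coe_toNNReal _ hs2.le, Real.sqrt_mul (x := 2 * Real.pi) (by positivity) (1 - ρ ^ 2), mul_mul_mul_comm,
    ← mul_inv, ← Real.exp_add]
  congr 2
  field_simp
  ring

/-- The left side is the conditional law of `Y` given `X = x`; this identifies `mehler` as the
density of the pair relative to the product of its marginals. -/
theorem gaussianReal_eq_withDensity_mehler {ρ : ℝ} (hρ : ρ ∈ Set.Ico (0 : ℝ) 1) (x : ℝ) :
    gaussianReal (ρ * x) (1 - ρ ^ 2).toNNReal =
      (gaussianReal 0 1).withDensity (mehler ρ x) := by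
  have hs2 : 0 < 1 - ρ ^ 2 := by nlinarith [hρ.1, hρ.2]
  have hm : Measurable (mehler ρ x) :=
    (measurable_mehler ρ).of_uncurry_left
  have h : gaussianPDF (ρ * x) (1 - ρ ^ 2).toNNReal = gaussianPDF 0 1 * mehler ρ x :=
    funext fun y => (gaussianPDF_mul_mehler hρ x y).symm
  rw [gaussianReal_of_var_ne_zero 0 one_ne_zero,
    gaussianReal_of_var_ne_zero _ (Real.toNNReal_pos.2 hs2).ne', h,
    withDensity_mul _ (measurable_gaussianPDF 0 1) hm]

/-- The standard bivariate normal law with correlation `ρ`. -/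
noncomputable def bivariate (ρ : ℝ) : Measure (ℝ × ℝ) :=
  ((gaussianReal 0 1).prod (gaussianReal 0 1)).map fun w => (w.1, ρ * w.1 + √(1 - ρ ^ 2) * w.2)

instance (ρ : ℝ) : IsProbabilityMeasure (bivariate ρ) :=
  Measure.isProbabilityMeasure_map (by fun_prop)

theorem bivariate_eq_withDensity {ρ : ℝ} (hρ : ρ ∈ Set.Ico (0 : ℝ) 1) :
    bivariate ρ = ((gaussianReal 0 1).prod (gaussianReal 0 1)).withDensity
      (Function.uncurry (mehler ρ)) := by
  have hs2 : 0 < 1 - ρ ^ 2 := by nlinarith [hρ.1, hρ.2]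
  ext A hA
  rw [bivariate, withDensity_apply _ hA, ← lintegral_indicator hA,
    lintegral_prod _ ((measurable_mehler ρ).indicator hA).aemeasurable,
    Measure.map_apply (by fun_prop) hA, Measure.prod_apply (by measurability)]
  refine lintegral_congr fun x => ?_
  have hAx : MeasurableSet (Prod.mk x ⁻¹' A) := measurable_prodMk_left hA
  have : ∀ y, A.indicator (Function.uncurry (mehler ρ)) (x, y) =
      (Prod.mk x ⁻¹' A).indicator (mehler ρ x) y := fun y => rfl
  simp_rw [this]
  rw [lintegral_indicator hAx, ← withDensity_apply _ hAx, ← gaussianReal_eq_withDensity_mehler hρ]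
  have hmap : (gaussianReal 0 1).map (fun z => ρ * x + √(1 - ρ ^ 2) * z) =
      gaussianReal (ρ * x) (1 - ρ ^ 2).toNNReal := by
    rw [show (fun z => ρ * x + √(1 - ρ ^ 2) * z) = (fun z => ρ * x + z) ∘
      (fun z => √(1 - ρ ^ 2) * z) from rfl, ← Measure.map_map (by fun_prop) (by fun_prop),
      gaussianReal_map_const_mul, gaussianReal_map_const_add]
    congr 1
    · ring
    · ext
      simp [Real.sq_sqrt hs2.le, Real.coe_toNNReal _ hs2.le]
  rw [← hmap, Measure.map_apply (by fun_prop) hAx]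
  rfl

theorem lintegral_mehler {ρ : ℝ} (hρ : ρ ∈ Set.Ico (0 : ℝ) 1) (x : ℝ) :
    ∫⁻ y, mehler ρ x y ∂(gaussianReal 0 1) = 1 := by
  have := lintegral_mehler_mul_mehler hρ (t := 0) (by simp) x 0
  simpa [mehler_zero] using this

theorem fst_bivariate (ρ : ℝ) : (bivariate ρ).fst = gaussianReal 0 1 := by
  rw [bivariate, Measure.fst_map_prodMk (by fun_prop)]
  exact Measure.fst_prod

theorem snd_bivariate {ρ : ℝ} (hρ : ρ ∈ Set.Ico (0 : ℝ) 1) :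
    (bivariate ρ).snd = gaussianReal 0 1 := by
  ext A hA
  rw [Measure.snd_apply hA, bivariate_eq_withDensity hρ, withDensity_apply _ (measurable_snd hA),
    ← lintegral_indicator (measurable_snd hA), lintegral_prod_symm' _
      ((measurable_mehler ρ).indicator (measurable_snd hA))]
  have : ∀ y, ∫⁻ x, (Prod.snd ⁻¹' A).indicator (Function.uncurry (mehler ρ)) (x, y)
      ∂(gaussianReal 0 1) = A.indicator 1 y := by
    intro y
    by_cases hy : y ∈ A
    · rw [Set.indicator_of_mem hy, Pi.one_apply, ← lintegral_mehler hρ y]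
      refine lintegral_congr fun x => ?_
      rw [Set.indicator_of_mem (show (x, y) ∈ Prod.snd ⁻¹' A from hy), mehler_comm]
      rfl
    · simp [hy]
  simp_rw [this]
  rw [lintegral_indicator_one hA]

theorem bivariate_zero : bivariate 0 = (gaussianReal 0 1).prod (gaussianReal 0 1) := by
  simp [bivariate]

/-- Characteristic functions agree: writing the second coordinate as `ρ x + √(1 - ρ²) z` with
independent `x`, `z` splits the exponential into two one-dimensional ones. -/
theorem map_multivariateGaussian {ρ : ℝ} (hρ : ρ ∈ Set.Ico (0 : ℝ) 1) :
    (multivariateGaussian (0 : EuclideanSpace ℝ (Fin 2)) !![1, ρ; ρ, 1]).map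
      (fun w => (w 0, w 1)) = bivariate ρ := by
  have hs2 : 0 < 1 - ρ ^ 2 := by nlinarith [hρ.1, hρ.2]
  have hpos : (!![1, ρ; ρ, 1] : Matrix (Fin 2) (Fin 2) ℝ).PosSemidef := by
    refine Matrix.PosSemidef.of_dotProduct_mulVec_nonneg ?_ fun x => ?_
    · ext i j; fin_cases i <;> fin_cases j <;> simp
    · simp [Matrix.mulVec, dotProduct, Fin.sum_univ_two]
      nlinarith [sq_nonneg (x 0 + ρ * x 1), mul_nonneg hs2.le (sq_nonneg (x 1))]
  have hmg : multivariateGaussian (0 : EuclideanSpace ℝ (Fin 2)) !![1, ρ; ρ, 1] =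
      (bivariate ρ).map (fun p => !₂[p.1, p.2]) := by
    have hmeas : Measurable (fun p : ℝ × ℝ => (!₂[p.1, p.2] : EuclideanSpace ℝ (Fin 2))) := by
      fun_prop
    have := Measure.isProbabilityMeasure_map (μ := bivariate ρ) hmeas.aemeasurable
    refine Measure.ext_of_charFun (funext fun t => ?_)
    rw [charFun_multivariateGaussian hpos, charFun_apply, integral_map hmeas.aemeasurable
      (by fun_prop), bivariate, integral_map (by fun_prop)
      (Measurable.aestronglyMeasurable (by fun_prop))]
    have hsplit : ∀ w : ℝ × ℝ, Complex.exp (((inner ℝ (!₂[w.1, ρ * w.1 + √(1 - ρ ^ 2) * w.2] :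
        EuclideanSpace ℝ (Fin 2)) t : ℝ) : ℂ) * Complex.I) =
        Complex.exp (((t 0 + ρ * t 1 : ℝ) : ℂ) * (w.1 : ℂ) * Complex.I) *
          Complex.exp (((√(1 - ρ ^ 2) * t 1 : ℝ) : ℂ) * (w.2 : ℂ) * Complex.I) := by
      intro w
      rw [← Complex.exp_add, PiLp.inner_apply, Fin.sum_univ_two]
      congr 1
      simp
      ring
    simp_rw [hsplit]
    rw [integral_prod_mul (fun x : ℝ => Complex.exp (((t 0 + ρ * t 1 : ℝ) : ℂ) * (x : ℂ) * Complex.I))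
      (fun z : ℝ => Complex.exp (((√(1 - ρ ^ 2) * t 1 : ℝ) : ℂ) * (z : ℂ) * Complex.I)),
      ← charFun_apply_real, ← charFun_apply_real, charFun_gaussianReal, charFun_gaussianReal,
      ← Complex.exp_add]
    congr 1
    have h4 : ((√(1 - ρ ^ 2) : ℝ) : ℂ) ^ 2 = 1 - (ρ : ℂ) ^ 2 := by
      rw [← Complex.ofReal_pow, Real.sq_sqrt hs2.le]; push_cast; ring
    simp [Matrix.mulVec, dotProduct, Fin.sum_univ_two]
    rw [mul_pow, h4]
    ring
  rw [hmg, Measure.map_map (by fun_prop) (by fun_prop)]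
  exact Measure.map_id

end Mehler

/-! ### Sums of cyclic kernel integrals over permutations. -/

section PermTrace

variable {𝒳 : Type*} [MeasurableSpace 𝒳]

/-- A semigroup of kernels on a probability space, indexed by `[0, 1)` with
multiplication, together with its traces. -/
structure KernelSemigroup (μ : Measure 𝒳) (κ : ℝ → 𝒳 → 𝒳 → ENNReal) (a : ℝ → ENNReal) : Prop where
  measurable : ∀ t, Measurable (Function.uncurry (κ t))
  comp : ∀ s ∈ Set.Ico (0 : ℝ) 1, ∀ t ∈ Set.Ico (0 : ℝ) 1, ∀ x y,
    ∫⁻ z, κ s x z * κ t z y ∂μ = κ (s * t) x y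
  trace : ∀ t ∈ Set.Ico (0 : ℝ) 1, ∫⁻ x, κ t x x ∂μ = a t

/-- The sum over all permutations `σ` of the cyclic kernel integrals, with parameter `t i` at the
edge from `i` to `σ i`. -/
noncomputable def permTrace (μ : Measure 𝒳) (κ : ℝ → 𝒳 → 𝒳 → ENNReal) {n : ℕ} (t : Fin n → ℝ) :
    ENNReal :=
  ∑ σ : Equiv.Perm (Fin n), ∫⁻ x, ∏ i, κ (t i) (x i) (x (σ i)) ∂(Measure.pi fun _ : Fin n => μ)

variable {μ : Measure 𝒳} {κ : ℝ → 𝒳 → 𝒳 → ENNReal} {a : ℝ → ENNReal}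

theorem permTrace_zero (t : Fin 0 → ℝ) : permTrace μ κ t = 1 := by
  simp [permTrace]

theorem KernelSemigroup.measurable_comp₂ (hκ : KernelSemigroup μ κ a) {Z : Type*}
    [MeasurableSpace Z] {f g : Z → 𝒳} (hf : Measurable f) (hg : Measurable g) (t : ℝ) :
    Measurable fun z => κ t (f z) (g z) :=
  (hκ.measurable t).comp (hf.prodMk hg)

variable [IsProbabilityMeasure μ]

/-- Conjugating the permutations relabels the points. This allows any chosen edge to be moved to
index `0`. -/
theorem permTrace_comp_equiv (hκ : KernelSemigroup μ κ a) {n : ℕ} (t : Fin n → ℝ)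
    (τ : Equiv.Perm (Fin n)) : permTrace μ κ (t ∘ τ) = permTrace μ κ t := by
  symm
  unfold permTrace
  rw [← (Equiv.permCongr τ).sum_comp]
  refine Finset.sum_congr rfl fun σ _ => ?_
  have h := measurePreserving_piCongrLeft (fun _ : Fin n => μ) τ
  rw [← h.lintegral_comp (Finset.measurable_prod _ fun i _ => hκ.measurable_comp₂
    (measurable_pi_apply _) (measurable_pi_apply _) _)]
  refine lintegral_congr fun x => ?_
  rw [← Equiv.prod_comp τ]
  refine Finset.prod_congr rfl fun i _ => ?_
  have h1 : ∀ j, (MeasurableEquiv.piCongrLeft (fun _ : Fin n => 𝒳) τ) x (τ j) = x j := fun j =>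
    Equiv.piCongrLeft_apply_apply (fun _ => 𝒳) τ x j
  rw [h1, show (Equiv.permCongr τ) σ (τ i) = τ (σ i) by simp, h1]
  rfl

/-- Integrating out the point `0`: if it is fixed it yields a trace; if it lies between `i` and its
successor, the two adjacent edges merge by the semigroup property into one edge with the product
parameter. -/
theorem permTrace_succ (hκ : KernelSemigroup μ κ a) {n : ℕ} {t : Fin (n + 1) → ℝ}
    (ht : ∀ i, t i ∈ Set.Ico (0 : ℝ) 1) :
    permTrace μ κ t = a (t 0) * permTrace μ κ (Fin.tail t) +
      ∑ i, permTrace μ κ (Function.update (Fin.tail t) i (t i.succ * t 0)) := by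
  unfold permTrace
  rw [← Equiv.Perm.decomposeFin.symm.sum_comp, Fintype.sum_prod_type, Fin.sum_univ_succ]
  congr 1
  · rw [Finset.mul_sum]
    refine Finset.sum_congr rfl fun e _ => ?_
    rw [lintegral_pi_succ _ (Finset.measurable_prod _ fun i _ => hκ.measurable_comp₂
      (measurable_pi_apply _) (measurable_pi_apply _) _)]
    simp only [Fin.prod_univ_succ, Equiv.Perm.decomposeFin_symm_apply_zero,
      Equiv.Perm.decomposeFin_symm_apply_succ, Equiv.swap_self, Equiv.refl_apply, Fin.cons_zero,
      Fin.cons_succ]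
    rw [← lintegral_const_mul _ (Finset.measurable_prod _ fun i _ => hκ.measurable_comp₂
      (measurable_pi_apply _) (measurable_pi_apply _) _)]
    refine lintegral_congr fun x => ?_
    rw [lintegral_mul_const _ (hκ.measurable_comp₂ (f := fun z => z) (g := fun z => z) measurable_id measurable_id _),
      hκ.trace _ (ht 0)]
    rfl
  · rw [Finset.sum_comm, Finset.sum_comm (s := (Finset.univ : Finset (Fin n)))]
    refine Finset.sum_congr rfl fun e _ => ?_
    -- The image of `0` is indexed as the successor of `e i`, so that the permutation runs `i → 0 →
    -- e i` and `i` names the edge that absorbs the parameter `t 0`.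
    rw [← Equiv.sum_comp e]
    refine Finset.sum_congr rfl fun i _ => ?_
    rw [lintegral_pi_succ _ (Finset.measurable_prod _ fun i _ => hκ.measurable_comp₂
      (measurable_pi_apply _) (measurable_pi_apply _) _)]
    refine lintegral_congr fun x => ?_
    have hsw : ∀ k, k ≠ i → Equiv.swap 0 (e i).succ (e k).succ = (e k).succ := fun k hk =>
      Equiv.swap_apply_of_ne_of_ne (Fin.succ_ne_zero _)
        fun h => hk (e.injective (Fin.succ_injective _ h))
    have hz : ∀ z, ∏ k, κ (t k) ((Fin.cons z x : Fin (n + 1) → 𝒳) k) ((Fin.cons z x :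
        Fin (n + 1) → 𝒳) (Equiv.Perm.decomposeFin.symm ((e i).succ, e) k)) =
        (κ (t i.succ) (x i) z * κ (t 0) z (x (e i))) *
          ∏ k ∈ Finset.univ.erase i, κ (t k.succ) (x k) (x (e k)) := by
      intro z
      rw [Fin.prod_univ_succ, ← Finset.mul_prod_erase _ _ (Finset.mem_univ i)]
      simp only [Equiv.Perm.decomposeFin_symm_apply_zero,
        Equiv.Perm.decomposeFin_symm_apply_succ, Fin.cons_zero, Fin.cons_succ,
        Equiv.swap_apply_right]
      rw [← mul_assoc, mul_comm (κ (t 0) _ _)]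
      congr 1
      refine Finset.prod_congr rfl fun k hk => ?_
      rw [hsw k (Finset.ne_of_mem_erase hk), Fin.cons_succ]
    simp_rw [hz]
    rw [lintegral_mul_const _ (Measurable.fun_mul
      (hκ.measurable_comp₂ (g := fun z => z) measurable_const measurable_id _)
      (hκ.measurable_comp₂ (f := fun z => z) measurable_id measurable_const _)), hκ.comp _ (ht _) _ (ht _),
      ← Finset.mul_prod_erase _ _ (Finset.mem_univ i), Function.update_self]
    congr 1
    refine Finset.prod_congr rfl fun k hk => ?_
    rw [Function.update_of_ne (Finset.ne_of_mem_erase hk)]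
    rfl

end PermTrace

/-! ### The comparison sequence and its recursion. -/

section GeometricBound

/-- The coefficients of the power series `(1 - r z) ^ (-S / r)`. -/
noncomputable def negBinCoeff (r S : ℝ) : ℕ → ℝ
  | 0 => 1
  | n + 1 => negBinCoeff r S n * (r * n + S) / (n + 1)

/-- The partial sums of `negBinCoeff`. -/
noncomputable def negBinSum (r S : ℝ) (n : ℕ) : ℝ := ∑ j ∈ Finset.range (n + 1), negBinCoeff r S j

variable {r S : ℝ}

theorem negBinCoeff_nonneg (hr : 0 ≤ r) (hS : 0 ≤ S) (n : ℕ) : 0 ≤ negBinCoeff r S n := by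
  induction n with
  | zero => simp [negBinCoeff]
  | succ n ih => simp only [negBinCoeff]; positivity

theorem negBinSum_nonneg (hr : 0 ≤ r) (hS : 0 ≤ S) (n : ℕ) : 0 ≤ negBinSum r S n :=
  Finset.sum_nonneg fun _ _ => negBinCoeff_nonneg hr hS _

theorem negBinSum_succ (n : ℕ) :
    negBinSum r S (n + 1) = negBinSum r S n + negBinCoeff r S (n + 1) :=
  Finset.sum_range_succ _ _

theorem negBinCoeff_succ_mul (n : ℕ) :
    (n + 1) * negBinCoeff r S (n + 1) = negBinCoeff r S n * (r * n + S) := by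
  have : (n + 1 : ℝ) ≠ 0 := by positivity
  simp only [negBinCoeff]
  field_simp

theorem negBinSum_bddAbove (hr : r ∈ Set.Ico (0 : ℝ) 1) (hS : 0 ≤ S) :
    ∃ C : ℝ, ∀ n, negBinSum r S n ≤ C := by
  have hsum : Summable (negBinCoeff r S) := by
    -- The ratio test below needs nonzero terms; a vanishing coefficient makes all later ones
    -- vanish. Otherwise the ratios tend to `r < 1`.
    by_cases h0 : ∃ n, negBinCoeff r S n = 0
    · obtain ⟨N, hN⟩ := h0
      have : ∀ n, negBinCoeff r S (N + n) = 0 := by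
        intro n
        induction n with
        | zero => simpa using hN
        | succ n ih => rw [← add_assoc, negBinCoeff, ih]; simp
      refine summable_of_ne_finset_zero (s := Finset.range N) fun b hb => ?_
      have hb' : N ≤ b := by simpa using hb
      obtain ⟨k, rfl⟩ := Nat.exists_eq_add_of_le hb'
      exact this k
    · push Not at h0
      refine summable_of_ratio_test_tendsto_lt_one hr.2 (Eventually.of_forall h0) ?_
      have h1 : ∀ n : ℕ, ‖negBinCoeff r S (n + 1)‖ / ‖negBinCoeff r S n‖ =
          r + (S - r) * (1 / ((n : ℝ) + 1)) := by
        intro n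
        have hpos : (0 : ℝ) < n + 1 := by positivity
        have := negBinCoeff_succ_mul (r := r) (S := S) n
        rw [← norm_div, negBinCoeff, mul_div_assoc, mul_div_cancel_left₀ _ (h0 n), Real.norm_eq_abs,
          abs_of_nonneg (by have := hr.1; positivity)]
        field_simp
        ring
      simp_rw [h1]
      simpa using (tendsto_one_div_add_atTop_nhds_zero_nat (𝕜 := ℝ)).const_mul (S - r)
        |>.const_add r
  exact ⟨∑' n, negBinCoeff r S n, fun n =>
    hsum.sum_le_tsum _ fun i _ => negBinCoeff_nonneg hr.1 hS i⟩

theorem sum_reflect_succ (f g : ℕ → ℝ) (n : ℕ) :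
    ∑ j ∈ Finset.range (n + 2), f j * g (n + 1 - j) =
      f 0 * g (n + 1) + ∑ j ∈ Finset.range (n + 1), f (j + 1) * g (n - j) := by
  rw [Finset.sum_range_succ', add_comm]
  simp [Nat.add_sub_add_right]

/-- With `F = (1 - r z)^(-S/r)`, this is the coefficient form of `r F' = r S F / (1 - r z)`, after
expressing the right side through `F / (1 - z)`, whose coefficients are the partial sums. -/
theorem mul_negBinCoeff_succ_eq (n : ℕ) :
    r * ((n + 1) * negBinCoeff r S (n + 1)) =
      S * (negBinSum r S n - (1 - r) * ∑ j ∈ Finset.range (n + 1), r ^ j * negBinSum r S (n - j)) := by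
  induction n with
  | zero => simp [negBinCoeff, negBinSum, mul_comm]
  | succ n ih =>
    have h1 := negBinCoeff_succ_mul (r := r) (S := S) (n + 1)
    have h2 : ∑ j ∈ Finset.range (n + 1), r ^ (j + 1) * negBinSum r S (n - j) =
        r * ∑ j ∈ Finset.range (n + 1), r ^ j * negBinSum r S (n - j) := by
      rw [Finset.mul_sum]; exact Finset.sum_congr rfl fun _ _ => by ring
    rw [h1, sum_reflect_succ (fun j => r ^ j), h2, negBinSum_succ]
    push_cast
    linear_combination r * ih

/-- The partial sums have generating function `(1 - z)⁻¹ (1 - r z)^(-S/r)`, whose logarithmic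
derivative is `1 / (1 - z) + S / (1 - r z)`, with coefficients `1 + S r ^ j`. -/
theorem negBinSum_recursion (n : ℕ) :
    (n + 1) * negBinSum r S (n + 1) =
      ∑ j ∈ Finset.range (n + 1), (1 + S * r ^ j) * negBinSum r S (n - j) := by
  induction n with
  | zero => simp [negBinCoeff, negBinSum, Finset.sum_range_succ]
  | succ n ih =>
    have h1 := negBinCoeff_succ_mul (r := r) (S := S) (n + 1)
    have h3 := mul_negBinCoeff_succ_eq (r := r) (S := S) n
    have h2 : ∑ j ∈ Finset.range (n + 1), (1 + S * r ^ (j + 1)) * negBinSum r S (n - j) =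
        (∑ j ∈ Finset.range (n + 1), (1 + S * r ^ j) * negBinSum r S (n - j)) -
        S * (1 - r) * ∑ j ∈ Finset.range (n + 1), r ^ j * negBinSum r S (n - j) := by
      rw [Finset.mul_sum, ← Finset.sum_sub_distrib]
      exact Finset.sum_congr rfl fun _ _ => by ring
    rw [sum_reflect_succ (fun j => 1 + S * r ^ j), h2, ← ih, negBinSum_succ (n + 1)]
    push_cast at h1 ⊢
    have h4 := negBinSum_succ (r := r) (S := S) n
    linear_combination h1 + h3 - S * h4

end GeometricBound

/-! ### Bounding the permutation sums by the comparison sequence. -/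

section PermTraceBound

variable {𝒳 : Type*} [MeasurableSpace 𝒳] {μ : Measure 𝒳} [IsProbabilityMeasure μ]
  {κ : ℝ → 𝒳 → 𝒳 → ENNReal} {a : ℝ → ENNReal}

/-- The second bound follows the cycle through an edge with parameter at most `r ^ (k + 1)`. If this
cycle has `j` other points, its trace parameter is at most `r ^ (k + j + 1)`; there are `n! / (n -
j)!` ways to choose it, and the remaining `n - j` points are handled by the first bound. Conversely,
the second bound with `k = 0` is the recursion for the first, so both are proved together. -/
theorem permTrace_le_aux (hκ : KernelSemigroup μ κ a) {r r' S : ℝ} (hr : r ∈ Set.Ico (0 : ℝ) 1)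
    (hr' : 0 ≤ r') (hS : 0 ≤ S)
    (ha : ∀ k : ℕ, ∀ t, 0 ≤ t → t ≤ r ^ (k + 1) → a t ≤ ENNReal.ofReal (1 + S * r' ^ k)) (n : ℕ) :
    (∀ t : Fin n → ℝ, (∀ i, t i ∈ Set.Icc 0 r) →
      permTrace μ κ t ≤ ENNReal.ofReal (n.factorial * negBinSum r' S n)) ∧
    (∀ (k : ℕ) (t : Fin (n + 1) → ℝ), (∀ i, t i ∈ Set.Icc 0 r) → (∃ i, t i ≤ r ^ (k + 1)) →
      permTrace μ κ t ≤ ENNReal.ofReal (n.factorial *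
        ∑ j ∈ Finset.range (n + 1), (1 + S * r' ^ (k + j)) * negBinSum r' S (n - j))) := by
  have hlt : ∀ s, s ∈ Set.Icc 0 r → s ∈ Set.Ico (0 : ℝ) 1 := fun s hs => ⟨hs.1, hs.2.trans_lt hr.2⟩
  have hZ : ∀ k, 0 ≤ negBinSum r' S k := negBinSum_nonneg hr' hS
  induction n with
  | zero =>
    refine ⟨fun t _ => ?_, fun k t ht hk => ?_⟩
    · simp [permTrace_zero, negBinSum, negBinCoeff]
    · obtain ⟨i, hi⟩ := hk
      obtain rfl : i = 0 := by omega
      rw [permTrace_succ hκ fun i => hlt _ (ht i)]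
      simpa [permTrace_zero, negBinSum, negBinCoeff] using ha k _ (ht 0).1 hi
  | succ n ih =>
    have h1 : ∀ t : Fin (n + 1) → ℝ, (∀ i, t i ∈ Set.Icc 0 r) →
        permTrace μ κ t ≤ ENNReal.ofReal ((n + 1).factorial * negBinSum r' S (n + 1)) := by
      intro t ht
      refine (ih.2 0 t ht ⟨0, by simpa using (ht 0).2⟩).trans_eq ?_
      congr 1
      simp only [zero_add]
      rw [← negBinSum_recursion, Nat.factorial_succ]
      push_cast
      ring
    refine ⟨h1, fun k t ht hk => ?_⟩
    obtain ⟨i₀, hi₀⟩ := hk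
    -- Relabelling makes the small edge the one removed by `permTrace_succ`.
    wlog h0 : i₀ = 0 generalizing t i₀
    · rw [← permTrace_comp_equiv hκ t (Equiv.swap 0 i₀)]
      exact this (t ∘ Equiv.swap 0 i₀) (fun i => ht _) 0 (by simpa using hi₀) rfl
    subst h0
    rw [permTrace_succ hκ fun i => hlt _ (ht i)]
    have hA : a (t 0) * permTrace μ κ (Fin.tail t) ≤ ENNReal.ofReal ((1 + S * r' ^ k) *
        ((n + 1).factorial * negBinSum r' S (n + 1))) := by
      rw [ENNReal.ofReal_mul (by positivity)]
      exact mul_le_mul' (ha k _ (ht 0).1 hi₀) (h1 _ fun i => ht _)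
    have hB : ∀ i, permTrace μ κ (Function.update (Fin.tail t) i (t i.succ * t 0)) ≤
        ENNReal.ofReal (n.factorial * ∑ j ∈ Finset.range (n + 1),
          (1 + S * r' ^ (k + 1 + j)) * negBinSum r' S (n - j)) := by
      intro i
      -- Merging with another edge gains one more power of `r`, so the induction hypothesis applies
      -- with `k + 1`.
      have hmul : t i.succ * t 0 ≤ r ^ (k + 1 + 1) := by
        rw [pow_succ' r (k + 1)]
        exact mul_le_mul (ht _).2 hi₀ (ht _).1 hr.1
      refine ih.2 (k + 1) _ (fun j => ?_) ⟨i, by simpa using hmul⟩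
      by_cases hj : j = i
      · subst hj
        rw [Function.update_self]
        exact ⟨mul_nonneg (ht _).1 (ht _).1, hmul.trans (pow_le_of_le_one hr.1 hr.2.le (by simp))⟩
      · rw [Function.update_of_ne hj]
        exact ht _
    refine (add_le_add hA (Finset.sum_le_sum fun i _ => hB i)).trans_eq ?_
    have hpos : 0 ≤ ∑ j ∈ Finset.range (n + 1),
        (1 + S * r' ^ (k + 1 + j)) * negBinSum r' S (n - j) :=
      Finset.sum_nonneg fun j _ => mul_nonneg (by positivity) (hZ _)
    rw [Finset.sum_const, Finset.card_univ, Fintype.card_fin, nsmul_eq_mul,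
      ← ENNReal.ofReal_natCast, ← ENNReal.ofReal_mul (by positivity),
      ← ENNReal.ofReal_add (by have := hZ (n + 1); positivity) (by positivity)]
    congr 1
    rw [sum_reflect_succ (fun j => 1 + S * r' ^ (k + j)), Nat.factorial_succ]
    simp only [add_zero, ← add_assoc, add_right_comm k _ 1]
    push_cast
    ring

theorem permTrace_le (hκ : KernelSemigroup μ κ a) {r r' S : ℝ} (hr : r ∈ Set.Ico (0 : ℝ) 1)
    (hr' : 0 ≤ r') (hS : 0 ≤ S)
    (ha : ∀ k : ℕ, ∀ t, 0 ≤ t → t ≤ r ^ (k + 1) → a t ≤ ENNReal.ofReal (1 + S * r' ^ k)) {n : ℕ}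
    {t : Fin n → ℝ} (ht : ∀ i, t i ∈ Set.Icc 0 r) :
    permTrace μ κ t ≤ ENNReal.ofReal (n.factorial * negBinSum r' S n) :=
  (permTrace_le_aux hκ hr hr' hS ha n).1 t ht

end PermTraceBound

/-! ### The second moment of the likelihood ratio. -/

section SecondMoment

variable {𝒳 : Type*} [MeasurableSpace 𝒳]

/-- Permutations act transitively on injections, so averaging over injections equals averaging over
the orbit of a single one. -/
theorem card_perm_mul_sum_embedding {n m : ℕ} {M : Type*} [NonAssocSemiring M]
    (G : (Fin m ↪ Fin n) → M) (π : Fin m ↪ Fin n) :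
    (n.factorial : M) * ∑ π', G π' =
      (Fintype.card (Fin m ↪ Fin n) : M) * ∑ σ : Equiv.Perm (Fin n), G (π.trans σ.toEmbedding) := by
  have h1 : ∀ σ : Equiv.Perm (Fin n), ∑ π', G π' = ∑ π' : Fin m ↪ Fin n, G (π'.trans σ.toEmbedding) :=
    fun σ => (Equiv.sum_comp (Equiv.embeddingCongr (Equiv.refl (Fin m)) σ) G).symm
  have h2 : ∀ π' : Fin m ↪ Fin n, ∑ σ : Equiv.Perm (Fin n), G (π'.trans σ.toEmbedding) =
      ∑ σ : Equiv.Perm (Fin n), G (π.trans σ.toEmbedding) := by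
    intro π'
    obtain ⟨τ, hτ⟩ := Equiv.Perm.exists_extending_pair π π' π.injective π'.injective
    rw [← Equiv.sum_comp (Equiv.mulRight τ) fun σ : Equiv.Perm (Fin n) => G (π.trans σ.toEmbedding)]
    refine Finset.sum_congr rfl fun σ _ => congrArg G (Function.Embedding.ext fun i => ?_)
    simp [hτ]
  calc (n.factorial : M) * ∑ π', G π' = ∑ _σ : Equiv.Perm (Fin n), ∑ π', G π' := by
        rw [Finset.sum_const, Finset.card_univ, Fintype.card_perm, Fintype.card_fin, nsmul_eq_mul]
    _ = ∑ σ : Equiv.Perm (Fin n), ∑ π' : Fin m ↪ Fin n, G (π'.trans σ.toEmbedding) :=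
        Finset.sum_congr rfl fun σ _ => h1 σ
    _ = ∑ π' : Fin m ↪ Fin n, ∑ σ : Equiv.Perm (Fin n), G (π'.trans σ.toEmbedding) :=
        Finset.sum_comm
    _ = _ := by
        rw [Finset.sum_congr rfl fun π' _ => h2 π', Finset.sum_const, Finset.card_univ,
          nsmul_eq_mul]

variable {μ : Measure 𝒳} {κ : ℝ → 𝒳 → 𝒳 → ENNReal} {a : ℝ → ENNReal}

theorem sum_perm_eq_permTrace (h0 : ∀ x y, κ 0 x y = 1) (s : ℝ) {n m : ℕ} (π : Fin m ↪ Fin n) :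
    ∑ σ : Equiv.Perm (Fin n), ∫⁻ x, ∏ i, κ s (x (π i)) (x ((π.trans σ.toEmbedding) i))
        ∂(Measure.pi fun _ : Fin n => μ) =
      permTrace μ κ (Function.extend π (fun _ => s) fun _ => 0) := by
  refine Finset.sum_congr rfl fun σ _ => lintegral_congr fun x => ?_
  rw [← prod_extend π]
  refine Finset.prod_congr rfl fun j _ => ?_
  by_cases hj : ∃ i, π i = j
  · obtain ⟨i, rfl⟩ := hj
    simp only [π.injective.extend_apply]
    rfl
  · simp only [Function.extend_apply' _ _ _ hj, h0]

variable [IsProbabilityMeasure μ]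

/-- Each `y_i` occurs in exactly one factor of each likelihood; integrating it out composes the two
kernels. -/
theorem lintegral_likelihood_mul (hκ : KernelSemigroup μ κ a)
    (hsymm : ∀ t x y, κ t x y = κ t y x) {s : ℝ} (hs : s ∈ Set.Ico (0 : ℝ) 1) {n m : ℕ}
    (π π' : Fin m ↪ Fin n) :
    ∫⁻ w, likelihood (κ s) π w * likelihood (κ s) π' w
        ∂((Measure.pi fun _ : Fin n => μ).prod (Measure.pi fun _ : Fin m => μ)) =
      ∫⁻ x, ∏ i, κ (s * s) (x (π i)) (x (π' i)) ∂(Measure.pi fun _ : Fin n => μ) := by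
  rw [lintegral_prod _ ((measurable_likelihood (hκ.measurable s) π).fun_mul
    (measurable_likelihood (hκ.measurable s) π')).aemeasurable]
  refine lintegral_congr fun x => ?_
  simp only [likelihood, ← Finset.prod_mul_distrib]
  rw [lintegral_pi_prod μ (f := fun i y => κ s (x (π i)) y * κ s (x (π' i)) y)]
  · refine Finset.prod_congr rfl fun i _ => ?_
    rw [← hκ.comp s hs s hs]
    exact lintegral_congr fun y => by rw [hsymm s (x (π' i)) y]
  · exact fun i => Measurable.fun_mul
      (hκ.measurable_comp₂ (g := fun y => y) measurable_const measurable_id _)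
      (hκ.measurable_comp₂ (g := fun y => y) measurable_const measurable_id _)

theorem lintegral_mixedLikelihood_sq_le (hκ : KernelSemigroup μ κ a)
    (hsymm : ∀ t x y, κ t x y = κ t y x) (h0 : ∀ x y, κ 0 x y = 1) {s r' S : ℝ}
    (hs : s ∈ Set.Ico (0 : ℝ) 1) (hr' : 0 ≤ r') (hS : 0 ≤ S)
    (ha : ∀ k : ℕ, ∀ t, 0 ≤ t → t ≤ (s * s) ^ (k + 1) → a t ≤ ENNReal.ofReal (1 + S * r' ^ k))
    {n m : ℕ} (hmn : m ≤ n) :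
    ∫⁻ w, mixedLikelihood (κ s) n m w ^ 2
        ∂((Measure.pi fun _ : Fin n => μ).prod (Measure.pi fun _ : Fin m => μ)) ≤
      ENNReal.ofReal (negBinSum r' S n) := by
  have : Nonempty (Fin m ↪ Fin n) := ⟨Fin.castLEEmb hmn⟩
  have hss : s * s ∈ Set.Ico (0 : ℝ) 1 := ⟨mul_nonneg hs.1 hs.1, by nlinarith [hs.1, hs.2]⟩
  set N : ENNReal := (Fintype.card (Fin m ↪ Fin n) : ENNReal) with hN
  have hN0 : N ≠ 0 := by simpa [hN] using hmn
  have hNt : N ≠ ⊤ := ENNReal.natCast_ne_top _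
  set G : (Fin m ↪ Fin n) → (Fin m ↪ Fin n) → ENNReal := fun π π' =>
    ∫⁻ x, ∏ i, κ (s * s) (x (π i)) (x (π' i)) ∂(Measure.pi fun _ : Fin n => μ) with hG
  have hmeas : ∀ π : Fin m ↪ Fin n, Measurable (likelihood (κ s) π) :=
    fun π => measurable_likelihood (hκ.measurable s) π
  have hrow : ∀ π, ∑ π', G π π' ≤ N * ENNReal.ofReal (negBinSum r' S n) := by
    intro π
    have h1 := card_perm_mul_sum_embedding (G π) π
    rw [sum_perm_eq_permTrace h0 (s * s) π] at h1
    have h2 : permTrace μ κ (Function.extend π (fun _ => s * s) fun _ => 0) ≤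
        ENNReal.ofReal (n.factorial * negBinSum r' S n) := by
      refine permTrace_le hκ hss hr' hS ha fun j => ?_
      by_cases hj : ∃ i, π i = j
      · obtain ⟨i, rfl⟩ := hj
        simpa only [π.injective.extend_apply] using ⟨hss.1, le_rfl⟩
      · simpa only [Function.extend_apply' _ _ _ hj] using ⟨le_rfl, hss.1⟩
    rw [ENNReal.ofReal_mul (by positivity), ENNReal.ofReal_natCast] at h2
    have hf0 : (n.factorial : ENNReal) ≠ 0 := by exact_mod_cast n.factorial_ne_zero
    refine (ENNReal.mul_le_mul_iff_right hf0 (ENNReal.natCast_ne_top _)).1 ?_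
    rw [h1, mul_left_comm]
    exact mul_le_mul_right h2 _
  calc ∫⁻ w, mixedLikelihood (κ s) n m w ^ 2
        ∂((Measure.pi fun _ : Fin n => μ).prod (Measure.pi fun _ : Fin m => μ))
      = ∫⁻ w, (N⁻¹ * N⁻¹) * ∑ π, ∑ π', likelihood (κ s) π w * likelihood (κ s) π' w
        ∂((Measure.pi fun _ : Fin n => μ).prod (Measure.pi fun _ : Fin m => μ)) := by
        refine lintegral_congr fun w => ?_
        rw [mixedLikelihood, mul_pow, sq, sq, Finset.sum_mul_sum]
    _ = (N⁻¹ * N⁻¹) * ∑ π, ∑ π', G π π' := by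
        rw [lintegral_const_mul _ (Finset.measurable_sum _ fun π _ =>
          Finset.measurable_sum _ fun π' _ => (hmeas π).fun_mul (hmeas π')),
          lintegral_finsetSum _ fun π _ =>
          Finset.measurable_sum _ fun π' _ => (hmeas π).fun_mul (hmeas π')]
        congr 1
        refine Finset.sum_congr rfl fun π _ => ?_
        rw [lintegral_finsetSum _ fun π' _ => (hmeas π).fun_mul (hmeas π')]
        exact Finset.sum_congr rfl fun π' _ => lintegral_likelihood_mul hκ hsymm hs π π'
    _ ≤ (N⁻¹ * N⁻¹) * (N * (N * ENNReal.ofReal (negBinSum r' S n))) := by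
        refine mul_le_mul_right ((Finset.sum_le_sum fun π _ => hrow π).trans_eq ?_) _
        rw [Finset.sum_const, Finset.card_univ, nsmul_eq_mul]
    _ = ENNReal.ofReal (negBinSum r' S n) := by
        rw [mul_assoc, ← mul_assoc N⁻¹ N, ENNReal.inv_mul_cancel hN0 hNt, one_mul, ← mul_assoc,
          ENNReal.inv_mul_cancel hN0 hNt, one_mul]

/-- Integrate the pointwise bound `L ≤ c + L² / c`, which holds by comparing `L` with `c`. -/
theorem withDensity_apply_le_of_sq {Ω : Type*} [MeasurableSpace Ω] (P : Measure Ω) {L : Ω → ENNReal}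
    {M : ENNReal} (hM : ∫⁻ w, L w ^ 2 ∂P ≤ M) {c : ENNReal} (hc : c ≠ 0)
    (hc' : c ≠ ⊤) {A : Set Ω} (hA : MeasurableSet A) :
    P.withDensity L A ≤ c * P A + c⁻¹ * M := by
  have hle : ∀ w, L w ≤ c + c⁻¹ * L w ^ 2 := by
    intro w
    rcases le_total (L w) c with h | h
    · exact h.trans le_self_add
    · calc L w = c⁻¹ * (c * L w) := by
            rw [← mul_assoc, ENNReal.inv_mul_cancel hc hc', one_mul]
        _ ≤ c⁻¹ * L w ^ 2 := by rw [sq]; gcongr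
        _ ≤ _ := le_add_self
  rw [withDensity_apply _ hA]
  calc ∫⁻ w in A, L w ∂P ≤ ∫⁻ w in A, (c + c⁻¹ * L w ^ 2) ∂P := lintegral_mono hle
    _ = c * P A + c⁻¹ * ∫⁻ w in A, L w ^ 2 ∂P := by
        rw [lintegral_add_left measurable_const, setLIntegral_const,
          lintegral_const_mul' _ _ (ENNReal.inv_ne_top.2 hc)]
    _ ≤ _ := by gcongr; exact (setLIntegral_le_lintegral _ _).trans hM

end SecondMoment

/-! ### The Gaussian pair in dimension `d`. -/

section GaussianPair

/-- The product of the `mehler` densities over the coordinates. -/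
noncomputable def mehlerPi (d : ℕ) (ρ : ℝ) (x y : Fin d → ℝ) : ENNReal := ∏ j, mehler ρ (x j) (y j)

/-- The standard normal law on `ℝᵈ`. -/
noncomputable abbrev stdNormal (d : ℕ) : Measure (Fin d → ℝ) :=
  Measure.pi fun _ : Fin d => gaussianReal 0 1

theorem kernelSemigroup_mehlerPi (d : ℕ) :
    KernelSemigroup (stdNormal d) (mehlerPi d) fun t => ENNReal.ofReal ((1 - t)⁻¹ ^ d) where
  measurable t := by
    unfold mehlerPi Function.uncurry
    exact Finset.measurable_prod _ fun j _ => (measurable_mehler t).comp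
      (f := fun p : (Fin d → ℝ) × (Fin d → ℝ) => (p.1 j, p.2 j)) (by fun_prop)
  comp s hs t ht x y := by
    simp only [mehlerPi, ← Finset.prod_mul_distrib]
    rw [lintegral_pi_prod (gaussianReal 0 1) (f := fun j z => mehler s (x j) z * mehler t z (y j))]
    · exact Finset.prod_congr rfl fun j _ => lintegral_mehler_mul_mehler hs ht _ _
    · exact fun j => Measurable.fun_mul (measurable_mehler s).of_uncurry_left
        (measurable_mehler t).of_uncurry_right
  trace t ht := by
    simp only [mehlerPi]
    rw [lintegral_pi_prod (gaussianReal 0 1) (f := fun _ z => mehler t z z)]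
    · simp only [lintegral_mehler_self ht, Finset.prod_const, Finset.card_univ, Fintype.card_fin]
      rw [ENNReal.ofReal_pow (inv_nonneg.2 (by linarith [ht.2]))]
    · exact fun _ => by unfold mehler; fun_prop

theorem mehlerPi_comm (d : ℕ) (ρ : ℝ) (x y : Fin d → ℝ) : mehlerPi d ρ x y = mehlerPi d ρ y x :=
  Finset.prod_congr rfl fun _ _ => mehler_comm _ _ _

theorem mehlerPi_zero (d : ℕ) (x y : Fin d → ℝ) : mehlerPi d 0 x y = 1 :=
  Finset.prod_eq_one fun _ _ => mehler_zero _ _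

theorem gaussianPair_eq_map {ρ : ℝ} (hρ : ρ ∈ Set.Ico (0 : ℝ) 1) (d : ℕ) :
    gaussianPair d ρ = (Measure.pi fun _ : Fin d => bivariate ρ).map
      (unzipAlong (Function.Embedding.refl (Fin d))) := by
  have hm : Measurable fun w : EuclideanSpace ℝ (Fin 2) => (w 0, w 1) := by fun_prop
  have : SigmaFinite ((multivariateGaussian (0 : EuclideanSpace ℝ (Fin 2)) !![1, ρ; ρ, 1]).map
      fun w => (w 0, w 1)) := by rw [map_multivariateGaussian hρ]; infer_instance
  rw [gaussianPair, ← map_multivariateGaussian hρ, ← Measure.pi_map_pi fun _ => hm.aemeasurable,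
    Measure.map_map (by fun_prop) (by fun_prop)]
  rfl

/-- A `d`-dimensional pair is itself a planted sample of `d` scalar pairs under the identity
matching, so its density and its null law come from the general planted results. -/
theorem gaussianPair_eq_plantedLawGiven {ρ : ℝ} (hρ : ρ ∈ Set.Ico (0 : ℝ) 1) (d : ℕ) :
    gaussianPair d ρ = plantedLawGiven (bivariate ρ) (Function.Embedding.refl (Fin d)) := by
  rw [plantedLawGiven_eq_map, gaussianPair_eq_map hρ]

theorem isProbabilityMeasure_gaussianPair {ρ : ℝ} (hρ : ρ ∈ Set.Ico (0 : ℝ) 1) (d : ℕ) :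
    IsProbabilityMeasure (gaussianPair d ρ) := by
  rw [gaussianPair_eq_plantedLawGiven hρ]; infer_instance

theorem nullLaw_bivariate {ρ : ℝ} (hρ : ρ ∈ Set.Ico (0 : ℝ) 1) (d : ℕ) :
    nullLaw (bivariate ρ) d d = (stdNormal d).prod (stdNormal d) := by
  rw [nullLaw, fst_bivariate, snd_bivariate hρ]

theorem gaussianPair_eq_withDensity {ρ : ℝ} (hρ : ρ ∈ Set.Ico (0 : ℝ) 1) (d : ℕ) :
    gaussianPair d ρ = ((stdNormal d).prod (stdNormal d)).withDensity
      (Function.uncurry (mehlerPi d ρ)) := by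
  rw [gaussianPair_eq_plantedLawGiven hρ, plantedLawGiven_eq_withDensity _ _ (measurable_mehler ρ),
    nullLaw_bivariate hρ]
  · rfl
  · rw [fst_bivariate, snd_bivariate hρ, bivariate_eq_withDensity hρ]
  · rw [snd_bivariate hρ]; exact lintegral_mehler hρ

theorem gaussianPair_zero (d : ℕ) : gaussianPair d 0 = (stdNormal d).prod (stdNormal d) := by
  rw [gaussianPair_eq_withDensity (by simp)]
  have : Function.uncurry (mehlerPi d 0) = 1 := funext fun p => mehlerPi_zero d p.1 p.2
  rw [this, withDensity_one]

theorem fst_gaussianPair {ρ : ℝ} (hρ : ρ ∈ Set.Ico (0 : ℝ) 1) (d : ℕ) :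
    (gaussianPair d ρ).fst = stdNormal d := by
  rw [gaussianPair_eq_map hρ, Measure.fst, Measure.map_map (by fun_prop) (by fun_prop)]
  have := Measure.pi_map_pi (μ := fun _ : Fin d => bivariate ρ) (f := fun _ => Prod.fst)
    fun _ => measurable_fst.aemeasurable
  exact this.trans (by
    congr 1; funext i; exact fst_bivariate ρ)

theorem snd_gaussianPair {ρ : ℝ} (hρ : ρ ∈ Set.Ico (0 : ℝ) 1) (d : ℕ) :
    (gaussianPair d ρ).snd = stdNormal d := by
  rw [gaussianPair_eq_map hρ, Measure.snd, Measure.map_map (by fun_prop) (by fun_prop)]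
  have := Measure.pi_map_pi (μ := fun _ : Fin d => bivariate ρ) (f := fun _ => Prod.snd)
    fun _ => measurable_snd.aemeasurable
  exact this.trans (by
    congr 1; funext i; exact snd_bivariate hρ)

theorem lintegral_mehlerPi {ρ : ℝ} (hρ : ρ ∈ Set.Ico (0 : ℝ) 1) (d : ℕ) (x : Fin d → ℝ) :
    ∫⁻ y, mehlerPi d ρ x y ∂(stdNormal d) = 1 := by
  simp only [mehlerPi]
  rw [lintegral_pi_prod _ fun j => (measurable_mehler ρ).of_uncurry_left]
  exact Finset.prod_eq_one fun j _ => lintegral_mehler hρ _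

end GaussianPair

/-! ### Impossibility from a uniform second moment bound. -/

section Impossibility

/-- This is convexity of `t ↦ (1 - t)⁻ᵈ` between `0` and `t`. The induction on `d` multiplies the
chord bounds and uses `r² ≤ r`. -/
theorem inv_one_sub_pow_sub_one_le {r t : ℝ} (hr : r ∈ Set.Icc (0 : ℝ) 1) (ht : t ∈ Set.Ico (0 : ℝ) 1)
    (d : ℕ) : (1 - r * t)⁻¹ ^ d - 1 ≤ r * ((1 - t)⁻¹ ^ d - 1) := by
  have h1 : 0 < 1 - t := by linarith [ht.2]
  have hrt : r * t ≤ t := mul_le_of_le_one_left ht.1 hr.2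
  have h2 : 0 < 1 - r * t := by linarith
  have hone : ∀ k : ℕ, 1 ≤ (1 - t)⁻¹ ^ k := fun k =>
    one_le_pow₀ ((one_le_inv₀ h1).2 (by linarith [ht.1]))
  have hstep : (1 - r * t)⁻¹ - 1 ≤ r * ((1 - t)⁻¹ - 1) := by
    have e1 : (1 - r * t)⁻¹ - 1 = r * (t / (1 - r * t)) := by field_simp; ring
    have e2 : (1 - t)⁻¹ - 1 = t / (1 - t) := by field_simp; ring
    rw [e1, e2]
    exact mul_le_mul_of_nonneg_left (div_le_div_of_nonneg_left ht.1 h1 (by linarith)) hr.1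
  induction d with
  | zero => simp
  | succ d ih =>
    have ha : (1 - r * t)⁻¹ ^ d ≤ 1 + r * ((1 - t)⁻¹ ^ d - 1) := by linarith
    have hb : (1 - r * t)⁻¹ ≤ 1 + r * ((1 - t)⁻¹ - 1) := by linarith
    have hm := mul_le_mul ha hb (by positivity)
      (by nlinarith [hr.1, hone d])
    rw [pow_succ, pow_succ]
    have hd := hone d
    have h1' := hone 1
    rw [pow_one] at h1'
    nlinarith [mul_nonneg (mul_nonneg hr.1 (sub_nonneg.2 hr.2))
      (mul_nonneg (sub_nonneg.2 hd) (sub_nonneg.2 h1'))]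

theorem inv_one_sub_pow_le {r : ℝ} (hr : r ∈ Set.Ico (0 : ℝ) 1) (d k : ℕ) {t : ℝ}
    (ht : t ≤ r ^ (k + 1)) :
    (1 - t)⁻¹ ^ d ≤ 1 + ((1 - r)⁻¹ ^ d - 1) * r ^ k := by
  have hk : r ^ k ≤ 1 := pow_le_one₀ hr.1 hr.2.le
  have h1 := inv_one_sub_pow_sub_one_le (r := r ^ k) ⟨pow_nonneg hr.1 k, hk⟩ hr d
  rw [← pow_succ] at h1
  have hlt : r ^ (k + 1) < 1 := pow_lt_one₀ hr.1 hr.2 (by simp)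
  have h2 : (1 - t)⁻¹ ^ d ≤ (1 - r ^ (k + 1))⁻¹ ^ d := by
    have : 0 < 1 - r ^ (k + 1) := by linarith
    have : 0 < 1 - t := by linarith
    gcongr
  linarith

/-- A uniform bound on the second moment of the likelihood ratio of the Gaussian model bounds the
probabilities of events under the planted law by those under the null law. -/
theorem plantedLaw_gaussianPair_le {r S C : ℝ} (hS : 0 ≤ S)
    (hC : ∀ n, negBinSum r S n ≤ C) {d n m : ℕ} (hmn : m ≤ n) {ρ : ℝ} (hρ : ρ ∈ Set.Ioo (0 : ℝ) 1)
    (hρr : ρ ^ 2 ≤ r) (hρS : (1 - ρ ^ 2)⁻¹ ^ d - 1 ≤ S) {c : ENNReal} (hc : c ≠ 0) (hc' : c ≠ ⊤)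
    {A : Set (Data (Fin d → ℝ) (Fin d → ℝ) n m)} (hA : MeasurableSet A) :
    plantedLaw (gaussianPair d ρ) n m A ≤
      c * nullLaw (gaussianPair d ρ) n m A + c⁻¹ * ENNReal.ofReal C := by
  have hρ' : ρ ∈ Set.Ico (0 : ℝ) 1 := ⟨hρ.1.le, hρ.2⟩
  have := isProbabilityMeasure_gaussianPair hρ' d
  have hfst := fst_gaussianPair hρ' d
  have hsnd := snd_gaussianPair hρ' d
  have hr0 : 0 ≤ r := (sq_nonneg ρ).trans hρr
  have hρ2 : ρ ^ 2 < 1 := by nlinarith [hρ.1, hρ.2]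
  rw [plantedLaw_eq_withDensity _ ((kernelSemigroup_mehlerPi d).measurable ρ)
    (by rw [hfst, hsnd, gaussianPair_eq_withDensity hρ'])
    (by rw [hsnd]; exact lintegral_mehlerPi hρ' d)]
  refine withDensity_apply_le_of_sq _ ?_ hc hc' hA
  rw [nullLaw, hfst, hsnd]
  refine (lintegral_mixedLikelihood_sq_le (kernelSemigroup_mehlerPi d) (mehlerPi_comm d)
    (mehlerPi_zero d) hρ' hr0 hS (fun k t _ ht => ENNReal.ofReal_le_ofReal ?_) hmn).trans
    (ENNReal.ofReal_le_ofReal (hC n))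
  rw [← sq] at ht
  refine (inv_one_sub_pow_le ⟨sq_nonneg ρ, hρ2⟩ d k ht).trans ?_
  gcongr

/-- Failure along infinitely many `n` suffices, because both error probabilities must tend to `0`
along the full sequence. -/
theorem not_strongDetection_of_frequently {r S : ℝ} (hr : r ∈ Set.Ico (0 : ℝ) 1) (hS : 0 ≤ S)
    {m d : ℕ → ℕ} (hmn : ∀ n, m n ≤ n) {ρ : ℕ → ℝ} (hρ : ∀ n, ρ n ∈ Set.Ioo (0 : ℝ) 1)
    (h : ∃ᶠ n in atTop, ρ n ^ 2 ≤ r ∧ (1 - ρ n ^ 2)⁻¹ ^ (d n) - 1 ≤ S) :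
    ¬ StrongDetection (fun n => nullLaw (gaussianPair (d n) (ρ n)) n (m n))
      (fun n => plantedLaw (gaussianPair (d n) (ρ n)) n (m n)) := by
  rintro ⟨A, hA, h0, h1⟩
  obtain ⟨C, hC⟩ := negBinSum_bddAbove hr hS
  -- This choice makes the second moment term at most `1/4`. With the null term and the type II
  -- error also below `1/4`, the planted law would have total mass below `3/4`.
  set c : ENNReal := ENNReal.ofReal (4 * (|C| + 1)) with hc
  have hcpos : 0 < 4 * (|C| + 1) := by positivity
  have hc0 : c ≠ 0 := (ENNReal.ofReal_pos.2 hcpos).ne'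
  have hct : c ≠ ⊤ := ENNReal.ofReal_ne_top
  have hcC : c⁻¹ * ENNReal.ofReal C ≤ 4⁻¹ := by
    rw [hc, ← ENNReal.ofReal_inv_of_pos hcpos, ← ENNReal.ofReal_mul (by positivity),
      show (4 : ENNReal)⁻¹ = ENNReal.ofReal (4⁻¹) by
        rw [ENNReal.ofReal_inv_of_pos (by norm_num)]; norm_num]
    refine ENNReal.ofReal_le_ofReal ?_
    rw [inv_mul_le_iff₀ hcpos]
    linarith [le_abs_self C]
  have e0 : ∀ᶠ n in atTop, c * nullLaw (gaussianPair (d n) (ρ n)) n (m n) (A n) < 4⁻¹ := by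
    have : Tendsto (fun n => c * nullLaw (gaussianPair (d n) (ρ n)) n (m n) (A n)) atTop (𝓝 0) := by
      simpa using ENNReal.Tendsto.const_mul h0 (Or.inr hct)
    exact this.eventually_lt_const (by simp)
  have e1 := h1.eventually_lt_const (show (0 : ENNReal) < 4⁻¹ by simp)
  obtain ⟨n, ⟨hr', hS'⟩, he0, he1⟩ := (h.and_eventually (e0.and e1)).exists
  have hρn : ρ n ∈ Set.Ico (0 : ℝ) 1 := ⟨(hρ n).1.le, (hρ n).2⟩
  have := isProbabilityMeasure_gaussianPair hρn (d n)
  have := isProbabilityMeasure_plantedLaw (hmn n) (gaussianPair (d n) (ρ n))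
  have hle := plantedLaw_gaussianPair_le hS hC (hmn n) (hρ n) hr' hS' hc0 hct (hA n)
  have htot := prob_add_prob_compl (μ := plantedLaw (gaussianPair (d n) (ρ n)) n (m n)) (hA n)
  have hlt : (1 : ENNReal) < 4⁻¹ + 4⁻¹ + 4⁻¹ := by
    rw [← htot]
    exact ENNReal.add_lt_add_of_le_of_lt (by finiteness)
      (hle.trans (add_le_add he0.le hcC)) he1
  have h4 : (4⁻¹ : ENNReal) = ENNReal.ofReal (4⁻¹) := by
    rw [ENNReal.ofReal_inv_of_pos (by norm_num)]; norm_num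
  rw [h4, ← ENNReal.ofReal_add (by norm_num) (by norm_num),
    ← ENNReal.ofReal_add (by norm_num) (by norm_num), ENNReal.one_lt_ofReal] at hlt
  norm_num at hlt

end Impossibility

/-! ### The threshold test built from a degenerate kernel. -/

section CrossSum

variable {𝒳 𝒴 : Type*} [MeasurableSpace 𝒳] [MeasurableSpace 𝒴]

/-- Resampling one coordinate preserves the product law, which allows that coordinate to be
integrated out first. -/
theorem measurePreserving_update {n : ℕ} (P : Measure 𝒳) [IsProbabilityMeasure P] (j : Fin n) :
    MeasurePreserving (fun q : (Fin n → 𝒳) × 𝒳 => Function.update q.1 j q.2)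
      ((Measure.pi fun _ : Fin n => P).prod P) (Measure.pi fun _ : Fin n => P) := by
  have hm : Measurable fun q : (Fin n → 𝒳) × 𝒳 => Function.update q.1 j q.2 := by
    refine measurable_pi_lambda _ fun k => ?_
    by_cases hk : k = j
    · subst hk; simp only [Function.update_self]; fun_prop
    · simp only [Function.update_of_ne hk]; fun_prop
  refine ⟨hm, (Measure.pi_eq fun s hs => ?_).symm⟩
  rw [Measure.map_apply hm (MeasurableSet.univ_pi hs)]
  have : (fun q : (Fin n → 𝒳) × 𝒳 => Function.update q.1 j q.2) ⁻¹' Set.univ.pi s =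
      (Set.univ.pi (Function.update s j Set.univ)) ×ˢ s j := by
    ext ⟨z, u⟩
    simp only [Set.mem_preimage, Set.mem_pi, Set.mem_univ, true_implies, Set.mem_prod]
    constructor
    · intro h
      refine ⟨fun k => ?_, by simpa using h j⟩
      by_cases hk : k = j
      · subst hk; simp
      · simpa [Function.update_of_ne hk] using h k
    · rintro ⟨h1, h2⟩ k
      by_cases hk : k = j
      · subst hk; simpa using h2
      · simpa [Function.update_of_ne hk] using h1 k
  rw [this, Measure.prod_prod, Measure.pi_pi, ← Finset.prod_erase_mul _ _ (Finset.mem_univ j),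
    ← Finset.prod_erase_mul _ (fun i => P (s i)) (Finset.mem_univ j)]
  simp only [Function.update_self, measure_univ, mul_one]
  congr 1
  exact Finset.prod_congr rfl fun k hk => by rw [Function.update_of_ne (Finset.ne_of_mem_erase hk)]

theorem integral_pi_eq_zero_of_update {n : ℕ} (P : Measure 𝒳) [IsProbabilityMeasure P] (j : Fin n)
    {F : (Fin n → 𝒳) → ℝ} (hF : Integrable F (Measure.pi fun _ : Fin n => P))
    (h : ∀ z, ∫ u, F (Function.update z j u) ∂P = 0) :
    ∫ z, F z ∂(Measure.pi fun _ : Fin n => P) = 0 := by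
  have hmp := measurePreserving_update P j
  rw [← hmp.map_eq, integral_map hmp.measurable.aemeasurable
    (by rw [hmp.map_eq]; exact hF.aestronglyMeasurable), integral_prod]
  · simp [h]
  · exact hmp.integrable_comp_of_integrable hF

theorem measurePreserving_cross {n : ℕ} (P : Measure (𝒳 × 𝒴)) [IsProbabilityMeasure P]
    {j k : Fin n} (hjk : j ≠ k) :
    MeasurePreserving (fun z : Fin n → 𝒳 × 𝒴 => ((z j).1, (z k).2))
      (Measure.pi fun _ : Fin n => P) (P.fst.prod P.snd) := by
  refine ⟨by fun_prop, ?_⟩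
  have hind : IndepFun (fun z : Fin n → 𝒳 × 𝒴 => (z j).1) (fun z => (z k).2)
      (Measure.pi fun _ : Fin n => P) :=
    ((iIndepFun_pi (μ := fun _ : Fin n => P) (X := fun _ => id)
      (fun _ => aemeasurable_id)).indepFun hjk).comp measurable_fst measurable_snd
  have hfst : MeasurePreserving (fun z : Fin n → 𝒳 × 𝒴 => (z j).1)
      (Measure.pi fun _ : Fin n => P) P.fst :=
    (⟨measurable_fst, rfl⟩ : MeasurePreserving Prod.fst P P.fst).comp
      (measurePreserving_eval (fun _ : Fin n => P) j)
  have hsnd : MeasurePreserving (fun z : Fin n → 𝒳 × 𝒴 => (z k).2)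
      (Measure.pi fun _ : Fin n => P) P.snd :=
    (⟨measurable_snd, rfl⟩ : MeasurePreserving Prod.snd P P.snd).comp
      (measurePreserving_eval (fun _ : Fin n => P) k)
  rw [(indepFun_iff_map_prod_eq_prod_map_map hfst.measurable.aemeasurable
    hsnd.measurable.aemeasurable).1 hind, hfst.map_eq, hsnd.map_eq]

/-- The sum of `g` over all pairs consisting of an `X` and a `Y`. -/
def crossSum (g : 𝒳 × 𝒴 → ℝ) {n m : ℕ} (w : Data 𝒳 𝒴 n m) : ℝ := ∑ i, ∑ j, g (w.1 j, w.2 i)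

@[fun_prop]
theorem measurable_crossSum {g : 𝒳 × 𝒴 → ℝ} (hg : Measurable g) (n m : ℕ) :
    Measurable (crossSum g : Data 𝒳 𝒴 n m → ℝ) := by
  unfold crossSum; fun_prop

/-- Kernels that are square integrable under a joint law and under the product of its marginals,
and centered in each variable. -/
structure IsDegenerateKernel (P : Measure (𝒳 × 𝒴)) (g : 𝒳 × 𝒴 → ℝ) : Prop where
  measurable : Measurable g
  memLp : MemLp g 2 P
  memLp_prod : MemLp g 2 (P.fst.prod P.snd)
  integral_fst : ∀ y, ∫ x, g (x, y) ∂P.fst = 0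
  integral_snd : ∀ x, ∫ y, g (x, y) ∂P.snd = 0

variable {P : Measure (𝒳 × 𝒴)} [IsProbabilityMeasure P] {g : 𝒳 × 𝒴 → ℝ}

theorem IsDegenerateKernel.prod (hg : IsDegenerateKernel P g) :
    IsDegenerateKernel (P.fst.prod P.snd) g where
  measurable := hg.measurable
  memLp := hg.memLp_prod
  memLp_prod := by simpa using hg.memLp_prod
  integral_fst := by simpa using hg.integral_fst
  integral_snd := by simpa using hg.integral_snd

theorem IsDegenerateKernel.integral_prod_eq_zero (hg : IsDegenerateKernel P g) :
    ∫ p, g p ∂(P.fst.prod P.snd) = 0 := by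
  rw [integral_prod _ (hg.memLp_prod.integrable one_le_two)]
  simp [hg.integral_snd]

theorem IsDegenerateKernel.memLp_cross (hg : IsDegenerateKernel P g) {n : ℕ} {j k : Fin n}
    (hjk : j ≠ k) :
    MemLp (fun z : Fin n → 𝒳 × 𝒴 => g ((z j).1, (z k).2)) 2 (Measure.pi fun _ : Fin n => P) :=
  hg.memLp_prod.comp_measurePreserving (measurePreserving_cross P hjk)

theorem IsDegenerateKernel.integral_cross_sq (hg : IsDegenerateKernel P g) {n : ℕ} {j k : Fin n}
    (hjk : j ≠ k) :
    ∫ z, g ((z j).1, (z k).2) ^ 2 ∂(Measure.pi fun _ : Fin n => P) =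
      ∫ p, g p ^ 2 ∂(P.fst.prod P.snd) := by
  rw [← (measurePreserving_cross P hjk).map_eq, integral_map (by fun_prop)
    (hg.measurable.pow_const 2).aestronglyMeasurable]

/-- Either `j` is absent from the second pair, or `k` is, since the two index pairs are neither
equal nor swapped. Integrating over the absent index first gives zero by centering. -/
theorem IsDegenerateKernel.integral_cross_mul_eq_zero (hg : IsDegenerateKernel P g) {n : ℕ}
    {j k j' k' : Fin n} (hjk : j ≠ k) (hjk' : j' ≠ k') (h1 : ¬(j' = j ∧ k' = k))
    (h2 : ¬(j' = k ∧ k' = j)) :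
    ∫ z, g ((z j).1, (z k).2) * g ((z j').1, (z k').2) ∂(Measure.pi fun _ : Fin n => P) = 0 := by
  have hint : Integrable (fun z : Fin n → 𝒳 × 𝒴 => g ((z j).1, (z k).2) * g ((z j').1, (z k').2))
      (Measure.pi fun _ : Fin n => P) := (hg.memLp_cross hjk).integrable_mul (hg.memLp_cross hjk')
  by_cases hj : j ≠ j' ∧ j ≠ k'
  · refine integral_pi_eq_zero_of_update P j hint fun z => ?_
    simp only [Function.update_self, Function.update_of_ne hjk.symm,
      Function.update_of_ne hj.1.symm, Function.update_of_ne hj.2.symm]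
    rw [integral_mul_const, ← integral_map (φ := Prod.fst) (f := fun x => g (x, (z k).2))
      (by fun_prop) (hg.measurable.comp (by fun_prop)).aestronglyMeasurable]
    change (∫ x, g (x, (z k).2) ∂P.fst) * _ = 0
    rw [hg.integral_fst, zero_mul]
  · have hk : k ≠ j' ∧ k ≠ k' := by grind
    refine integral_pi_eq_zero_of_update P k hint fun z => ?_
    simp only [Function.update_self, Function.update_of_ne hjk,
      Function.update_of_ne hk.1.symm, Function.update_of_ne hk.2.symm]
    rw [integral_mul_const, ← integral_map (φ := Prod.snd) (f := fun y => g ((z j).1, y))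
      (by fun_prop) (hg.measurable.comp (by fun_prop)).aestronglyMeasurable]
    change (∫ y, g ((z j).1, y) ∂P.snd) * _ = 0
    rw [hg.integral_snd, zero_mul]

/-- Only equal and swapped index pairs correlate. Hence each of the at most `n m` terms contributes
at most twice the second moment. -/
theorem IsDegenerateKernel.integral_offDiag_sq_le (hg : IsDegenerateKernel P g) {n m : ℕ}
    (π : Fin m ↪ Fin n) :
    ∫ z, (∑ p ∈ Finset.univ.filter fun p : Fin m × Fin n => p.2 ≠ π p.1,
        g ((z p.2).1, (z (π p.1)).2)) ^ 2 ∂(Measure.pi fun _ : Fin n => P) ≤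
      2 * n * m * ∫ p, g p ^ 2 ∂(P.fst.prod P.snd) := by
  set I := Finset.univ.filter fun p : Fin m × Fin n => p.2 ≠ π p.1 with hI
  set v := ∫ p, g p ^ 2 ∂(P.fst.prod P.snd) with hv
  have hv0 : 0 ≤ v := integral_nonneg fun _ => sq_nonneg _
  have hmem : ∀ p ∈ I, p.2 ≠ π p.1 := fun p hp => (Finset.mem_filter.1 hp).2
  have hL : ∀ p ∈ I, MemLp (fun z : Fin n → 𝒳 × 𝒴 => g ((z p.2).1, (z (π p.1)).2)) 2
      (Measure.pi fun _ : Fin n => P) := fun p hp => hg.memLp_cross (hmem p hp)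
  have hterm : ∀ p ∈ I, ∀ q ∈ I, ∫ z, g ((z p.2).1, (z (π p.1)).2) * g ((z q.2).1, (z (π q.1)).2)
      ∂(Measure.pi fun _ : Fin n => P) ≤
      (if q = p then v else 0) + if q.2 = π p.1 ∧ π q.1 = p.2 then v else 0 := by
    intro p hp q hq
    have hle : ∫ z, g ((z p.2).1, (z (π p.1)).2) * g ((z q.2).1, (z (π q.1)).2)
        ∂(Measure.pi fun _ : Fin n => P) ≤ v := by
      calc _ ≤ ∫ z, (1 / 2 * g ((z p.2).1, (z (π p.1)).2) ^ 2 +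
            1 / 2 * g ((z q.2).1, (z (π q.1)).2) ^ 2) ∂(Measure.pi fun _ : Fin n => P) := by
            refine integral_mono ((hL p hp).integrable_mul (hL q hq))
              (((hL p hp).integrable_sq.const_mul _).add ((hL q hq).integrable_sq.const_mul _))
              fun z => ?_
            nlinarith [sq_nonneg (g ((z p.2).1, (z (π p.1)).2) - g ((z q.2).1, (z (π q.1)).2))]
        _ = v := by
            rw [integral_add ((hL p hp).integrable_sq.const_mul _)
              ((hL q hq).integrable_sq.const_mul _), integral_const_mul, integral_const_mul,
              hg.integral_cross_sq (hmem p hp), hg.integral_cross_sq (hmem q hq)]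
            ring
    by_cases h1 : q = p
    · rw [if_pos h1]
      split_ifs <;> linarith
    · rw [if_neg h1]
      split_ifs with h2
      · linarith
      · rw [hg.integral_cross_mul_eq_zero (hmem p hp) (hmem q hq), zero_add]
        · rintro ⟨ha, hb⟩
          exact h1 (Prod.ext (π.injective hb) ha)
        · exact h2
  calc ∫ z, (∑ p ∈ I, g ((z p.2).1, (z (π p.1)).2)) ^ 2 ∂(Measure.pi fun _ : Fin n => P)
      = ∑ p ∈ I, ∑ q ∈ I, ∫ z, g ((z p.2).1, (z (π p.1)).2) * g ((z q.2).1, (z (π q.1)).2)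
          ∂(Measure.pi fun _ : Fin n => P) := by
        have hI2 : ∀ p ∈ I, ∀ q ∈ I, Integrable (fun z : Fin n → 𝒳 × 𝒴 =>
            g ((z p.2).1, (z (π p.1)).2) * g ((z q.2).1, (z (π q.1)).2))
            (Measure.pi fun _ : Fin n => P) := fun p hp q hq =>
          (hL p hp).integrable_mul (hL q hq)
        simp_rw [sq, Finset.sum_mul_sum]
        rw [integral_finsetSum _ fun p hp => integrable_finsetSum _ fun q hq => hI2 p hp q hq]
        refine Finset.sum_congr rfl fun p hp => ?_
        rw [integral_finsetSum _ fun q hq => hI2 p hp q hq]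
    _ ≤ ∑ p ∈ I, 2 * v := by
        refine Finset.sum_le_sum fun p hp => ?_
        refine (Finset.sum_le_sum fun q hq => hterm p hp q hq).trans ?_
        rw [Finset.sum_add_distrib, Finset.sum_ite_eq' I p, if_pos hp, two_mul]
        gcongr
        rw [← Finset.sum_filter, Finset.sum_const, nsmul_eq_mul]
        -- By injectivity of `π`, a term has at most one swapped partner.
        have hcard : (I.filter fun q => q.2 = π p.1 ∧ π q.1 = p.2).card ≤ 1 := by
          refine Finset.card_le_one.2 fun a ha b hb => ?_
          have ha' := (Finset.mem_filter.1 ha).2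
          have hb' := (Finset.mem_filter.1 hb).2
          exact Prod.ext (π.injective (ha'.2.trans hb'.2.symm)) (ha'.1.trans hb'.1.symm)
        exact mul_le_of_le_one_left hv0 (by exact_mod_cast hcard)
    _ ≤ 2 * n * m * v := by
        rw [Finset.sum_const, nsmul_eq_mul]
        have hcard : (I.card : ℝ) ≤ m * n := by
          have := Finset.card_le_univ I
          rw [Fintype.card_prod, Fintype.card_fin, Fintype.card_fin] at this
          exact_mod_cast this
        nlinarith [mul_le_mul_of_nonneg_right hcard hv0]

theorem integral_diag_sq_le (hg : MemLp g 2 P) (hm : Measurable g) {n m : ℕ} (π : Fin m ↪ Fin n) :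
    ∫ z, ((∑ i, g (z (π i))) - m * ∫ p, g p ∂P) ^ 2 ∂(Measure.pi fun _ : Fin n => P) ≤
      m * ∫ p, g p ^ 2 ∂P := by
  have hmp := fun j : Fin n => measurePreserving_eval (fun _ : Fin n => P) j
  have hL : ∀ j : Fin n, MemLp (fun z : Fin n → 𝒳 × 𝒴 => g (z j)) 2
      (Measure.pi fun _ : Fin n => P) := fun j => hg.comp_measurePreserving (hmp j)
  have hind : iIndepFun (fun (j : Fin n) (z : Fin n → 𝒳 × 𝒴) => g (z j))
      (Measure.pi fun _ : Fin n => P) := iIndepFun_pi (fun _ => hm.aemeasurable)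
  have hmean : ∀ j : Fin n, ∫ z, g (z j) ∂(Measure.pi fun _ : Fin n => P) = ∫ p, g p ∂P := by
    intro j
    conv_rhs => rw [← (hmp j).map_eq, integral_map (hmp j).measurable.aemeasurable
      hm.aestronglyMeasurable]
  have hvar := IndepFun.variance_sum (s := (Finset.univ : Finset (Fin m)))
    (X := fun i (z : Fin n → 𝒳 × 𝒴) => g (z (π i))) (μ := Measure.pi fun _ : Fin n => P)
    (fun i _ => hL (π i)) fun i _ i' _ hii => hind.indepFun (π.injective.ne hii)
  have hE : ∫ z, (∑ i, fun z : Fin n → 𝒳 × 𝒴 => g (z (π i))) z ∂(Measure.pi fun _ : Fin n => P) =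
      m * ∫ p, g p ∂P := by
    simp only [Finset.sum_apply]
    rw [integral_finsetSum _ fun i _ => (hL (π i)).integrable one_le_two]
    simp [hmean]
  rw [variance_eq_integral (Finset.aemeasurable_sum _ fun i _ => (hL (π i)).aemeasurable), hE] at hvar
  simp only [Finset.sum_apply] at hvar
  rw [hvar]
  refine (Finset.sum_le_sum (g := fun _ => ∫ p, g p ^ 2 ∂P) fun i _ => ?_).trans_eq (by simp)
  refine (variance_le_expectation_sq (hL (π i)).aestronglyMeasurable).trans_eq ?_
  conv_rhs => rw [← (hmp (π i)).map_eq, integral_map (hmp (π i)).measurable.aemeasurable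
    (hm.pow_const 2).aestronglyMeasurable]
  rfl

/-- The matched pairs carry the mean and have independent fluctuations; the unmatched pairs are
centered noise. The two parts are combined by `(a + b)² ≤ 2 a² + 2 b²`. -/
theorem IsDegenerateKernel.integral_crossSum_sq_le (hg : IsDegenerateKernel P g) {n m : ℕ}
    (π : Fin m ↪ Fin n) :
    Integrable (fun w => (crossSum g w - m * ∫ p, g p ∂P) ^ 2) (plantedLawGiven P π) ∧
    ∫ w, (crossSum g w - m * ∫ p, g p ∂P) ^ 2 ∂(plantedLawGiven P π) ≤
      2 * m * ∫ p, g p ^ 2 ∂P + 4 * n * m * ∫ p, g p ^ 2 ∂(P.fst.prod P.snd) := by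
  have hgm := hg.measurable
  have hsplit : ∀ z : Fin n → 𝒳 × 𝒴, crossSum g (unzipAlong π z) - m * ∫ p, g p ∂P =
      ((∑ i, g (z (π i))) - m * ∫ p, g p ∂P) +
        ∑ p ∈ Finset.univ.filter fun p : Fin m × Fin n => p.2 ≠ π p.1,
          g ((z p.2).1, (z (π p.1)).2) := by
    intro z
    have : crossSum g (unzipAlong π z) = ∑ p : Fin m × Fin n, g ((z p.2).1, (z (π p.1)).2) := by
      rw [Fintype.sum_prod_type]; rfl
    rw [this, ← Finset.sum_filter_add_sum_filter_not Finset.univ fun p : Fin m × Fin n =>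
      p.2 = π p.1, add_sub_right_comm]
    congr 2
    refine (Finset.sum_bij (fun i _ => (i, π i)) (by simp) (fun _ _ _ _ h => (Prod.ext_iff.1 h).1)
      ?_ (by simp)).symm
    rintro ⟨i, j⟩ hp
    simp only [Finset.mem_filter, Finset.mem_univ, true_and] at hp
    exact ⟨i, Finset.mem_univ _, by rw [hp]⟩
  have hLd : MemLp (fun z : Fin n → 𝒳 × 𝒴 => (∑ i, g (z (π i))) - m * ∫ p, g p ∂P) 2
      (Measure.pi fun _ : Fin n => P) :=
    (memLp_finsetSum _ fun i _ => hg.memLp.comp_measurePreserving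
      (measurePreserving_eval (fun _ : Fin n => P) (π i))).sub (memLp_const _)
  have hLo : MemLp (fun z : Fin n → 𝒳 × 𝒴 => ∑ p ∈ Finset.univ.filter
      fun p : Fin m × Fin n => p.2 ≠ π p.1, g ((z p.2).1, (z (π p.1)).2)) 2
      (Measure.pi fun _ : Fin n => P) :=
    memLp_finsetSum _ fun p hp => hg.memLp_cross (Finset.mem_filter.1 hp).2
  have hmeas : Measurable fun w : Data 𝒳 𝒴 n m => (crossSum g w - m * ∫ p, g p ∂P) ^ 2 := by
    fun_prop
  rw [plantedLawGiven_eq_map, integrable_map_measure hmeas.aestronglyMeasurable (by fun_prop),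
    integral_map (by fun_prop) hmeas.aestronglyMeasurable]
  simp only [Function.comp_def, hsplit]
  refine ⟨(hLd.add hLo).integrable_sq, ?_⟩
  calc _ ≤ ∫ z, (2 * ((∑ i, g (z (π i))) - m * ∫ p, g p ∂P) ^ 2 +
        2 * (∑ p ∈ Finset.univ.filter fun p : Fin m × Fin n => p.2 ≠ π p.1,
          g ((z p.2).1, (z (π p.1)).2)) ^ 2) ∂(Measure.pi fun _ : Fin n => P) := by
        refine integral_mono (hLd.add hLo).integrable_sq
          ((hLd.integrable_sq.const_mul 2).add (hLo.integrable_sq.const_mul 2)) fun z => ?_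
        exact add_sq_le.trans_eq (by ring)
    _ ≤ _ := by
        rw [integral_add (hLd.integrable_sq.const_mul 2) (hLo.integrable_sq.const_mul 2),
          integral_const_mul, integral_const_mul]
        have h1 := integral_diag_sq_le hg.memLp hgm π
        have h2 := hg.integral_offDiag_sq_le π
        linarith

theorem IsDegenerateKernel.measure_deviation_le (hg : IsDegenerateKernel P g) {n m : ℕ}
    (π : Fin m ↪ Fin n) {c : ℝ} (hc : 0 < c) {A : Set (Data 𝒳 𝒴 n m)}
    (hA : ∀ w ∈ A, c ≤ |crossSum g w - m * ∫ p, g p ∂P|) :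
    plantedLawGiven P π A ≤ ENNReal.ofReal ((2 * m * ∫ p, g p ^ 2 ∂P +
      4 * n * m * ∫ p, g p ^ 2 ∂(P.fst.prod P.snd)) / c ^ 2) := by
  obtain ⟨hint, hle⟩ := hg.integral_crossSum_sq_le π
  have hmk := mul_meas_ge_le_integral_of_nonneg (ae_of_all _ fun w => sq_nonneg _) hint (c ^ 2)
  have hsub : A ⊆ {w | c ^ 2 ≤ (crossSum g w - m * ∫ p, g p ∂P) ^ 2} := fun w hw => by
    rw [Set.mem_ofPred_eq, ← sq_abs (crossSum g w - _)]
    exact pow_le_pow_left₀ hc.le (hA w hw) 2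
  refine (measure_mono hsub).trans ?_
  rw [← ofReal_measureReal]
  refine ENNReal.ofReal_le_ofReal ?_
  rw [le_div_iff₀ (by positivity), mul_comm]
  exact hmk.trans hle

/-- The threshold test based on `crossSum` has small error probabilities. -/
theorem IsDegenerateKernel.exists_test (hg : IsDegenerateKernel P g) {n m : ℕ} (hmn : m ≤ n)
    (hm : 0 < m) (hpos : 0 < ∫ p, g p ∂P) {E : ℝ}
    (hE : (8 * ∫ p, g p ^ 2 ∂P) / (m * (∫ p, g p ∂P) ^ 2) +
      (24 * (n / m) * ∫ p, g p ^ 2 ∂(P.fst.prod P.snd)) / (∫ p, g p ∂P) ^ 2 ≤ E) :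
    ∃ A : Set (Data 𝒳 𝒴 n m), MeasurableSet A ∧ nullLaw P n m A ≤ ENNReal.ofReal E ∧
      plantedLaw P n m Aᶜ ≤ ENNReal.ofReal E := by
  set e := ∫ p, g p ∂P with he
  set vP := ∫ p, g p ^ 2 ∂P with hvP
  set v := ∫ p, g p ^ 2 ∂(P.fst.prod P.snd) with hv
  have hvP0 : 0 ≤ vP := integral_nonneg fun _ => sq_nonneg _
  have hv0 : 0 ≤ v := integral_nonneg fun _ => sq_nonneg _
  have hm' : (0 : ℝ) < m := by exact_mod_cast hm
  have hmn' : (m : ℝ) ≤ n := by exact_mod_cast hmn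
  have hn' : (1 : ℝ) ≤ n := by exact_mod_cast hm.trans_le hmn
  have : Nonempty (Fin m ↪ Fin n) := ⟨Fin.castLEEmb hmn⟩
  -- The threshold is halfway between the null mean `0` and the planted mean `m e`.
  have hc : 0 < m * e / 2 := by positivity
  have hEq : (8 * vP) / (m * e ^ 2) + (24 * (n / m) * v) / e ^ 2 =
      (2 * m * vP + 6 * n * m * v) / (m * e / 2) ^ 2 := by
    field_simp
    ring
  -- The coefficient `6` serves both errors: the planted law needs `4`, and for the null law the
  -- diagonal term `2 m v` is absorbed into `2 n m v`.
  have hB : ∀ B, B ≤ 2 * m * vP + 6 * n * m * v →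
      ENNReal.ofReal (B / (m * e / 2) ^ 2) ≤ ENNReal.ofReal E := fun B hB => by
    refine ENNReal.ofReal_le_ofReal (le_trans ?_ hE)
    rw [hEq]
    gcongr
  have hnm : 0 ≤ n * m * v := by positivity
  refine ⟨{w | m * e / 2 ≤ crossSum g w}, measurableSet_le measurable_const
    (measurable_crossSum hg.measurable n m), ?_, ?_⟩
  · rw [nullLaw_eq_plantedLawGiven (Fin.castLEEmb hmn)]
    refine (hg.prod.measure_deviation_le _ hc fun w hw => ?_).trans (hB _ ?_)
    · rw [hg.integral_prod_eq_zero, mul_zero, sub_zero]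
      exact le_trans hw (le_abs_self _)
    · rw [Measure.fst_prod, Measure.snd_prod]
      have : (m : ℝ) * v ≤ n * m * v := by nlinarith [mul_nonneg hm'.le hv0]
      have : 0 ≤ m * vP := by positivity
      linarith
  · rw [plantedLaw, Measure.smul_apply, Measure.finsetSum_apply, smul_eq_mul,
      ENNReal.inv_mul_le_iff (by simpa using hmn) (by simp)]
    refine (Finset.sum_le_sum (g := fun _ => ENNReal.ofReal E) fun π _ => ?_).trans_eq (by simp)
    refine (hg.measure_deviation_le π hc fun w hw => ?_).trans (hB _ ?_)
    · have hw' : crossSum g w < m * e / 2 := by simpa using hw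
      rw [abs_sub_comm]
      exact le_trans (by linarith) (le_abs_self _)
    · linarith

end CrossSum

/-- The hypothesis says that the optimal maximal error tends to `0`. Tests within `1 / (n + 1)` of
this infimum then work for all `ε` at once. -/
theorem strongDetection_of_forall_eps {Ω : ℕ → Type*} [∀ n, MeasurableSpace (Ω n)]
    {P₀ P₁ : ∀ n, Measure (Ω n)}
    (h : ∀ ε : ℝ, 0 < ε → ∀ᶠ n in atTop, ∃ A, MeasurableSet A ∧ P₀ n A ≤ ENNReal.ofReal ε ∧
      P₁ n Aᶜ ≤ ENNReal.ofReal ε) : StrongDetection P₀ P₁ := by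
  set f : ℕ → ENNReal := fun n =>
    ⨅ A : {A : Set (Ω n) // MeasurableSet A}, max (P₀ n A) (P₁ n (A : Set (Ω n))ᶜ) with hf
  have hf0 : Tendsto f atTop (𝓝 0) := by
    refine ENNReal.tendsto_nhds_zero.2 fun ε hε => ?_
    obtain ⟨δ, hδ, hδε⟩ := ENNReal.lt_iff_exists_nnreal_btwn.1 hε
    filter_upwards [h δ (by simpa using hδ)] with n ⟨A, hA, h0, h1⟩
    rw [ENNReal.ofReal_coe_nnreal] at h0 h1
    exact (iInf_le _ (⟨A, hA⟩ : {A : Set (Ω n) // MeasurableSet A})).trans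
      ((max_le h0 h1).trans hδε.le)
  have hex : ∀ n, ∃ A : {A : Set (Ω n) // MeasurableSet A},
      max (P₀ n A) (P₁ n (A : Set (Ω n))ᶜ) ≤ f n + ENNReal.ofReal (1 / ((n : ℝ) + 1)) := by
    intro n
    by_cases htop : f n = ⊤
    · exact ⟨⟨∅, MeasurableSet.empty⟩, by simp [htop]⟩
    · obtain ⟨A, hA⟩ := iInf_lt_iff.1 (ENNReal.lt_add_right htop
        (ENNReal.ofReal_pos.2 (by positivity : 0 < 1 / ((n : ℝ) + 1))).ne')
      exact ⟨A, hA.le⟩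
  choose A hA using hex
  have hlim : Tendsto (fun n => f n + ENNReal.ofReal (1 / ((n : ℝ) + 1))) atTop (𝓝 0) := by
    simpa using hf0.add (ENNReal.tendsto_ofReal
      (tendsto_one_div_add_atTop_nhds_zero_nat (𝕜 := ℝ)))
  exact ⟨fun n => A n, fun n => (A n).2,
    tendsto_of_tendsto_of_tendsto_of_le_of_le tendsto_const_nhds hlim (fun _ => zero_le)
      fun n => (le_max_left _ _).trans (hA n),
    tendsto_of_tendsto_of_tendsto_of_le_of_le tendsto_const_nhds hlim (fun _ => zero_le)
      fun n => (le_max_right _ _).trans (hA n)⟩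

/-! ### Moments of the inner product kernel. -/

section Dot

theorem measurePreserving_fst_bivariate (ρ : ℝ) :
    MeasurePreserving Prod.fst (bivariate ρ) (gaussianReal 0 1) :=
  ⟨measurable_fst, fst_bivariate ρ⟩

theorem measurePreserving_snd_bivariate {ρ : ℝ} (hρ : ρ ∈ Set.Ico (0 : ℝ) 1) :
    MeasurePreserving Prod.snd (bivariate ρ) (gaussianReal 0 1) :=
  ⟨measurable_snd, snd_bivariate hρ⟩

theorem integrable_pow_four_gaussian : Integrable (fun x : ℝ => x ^ 4) (gaussianReal 0 1) := by
  have h := (memLp_id_gaussianReal (μ := 0) (v := 1) 4).integrable_norm_pow (p := 4) (by norm_num)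
  refine h.congr (ae_of_all _ fun x => ?_)
  simp [Real.norm_eq_abs, Even.pow_abs (show Even 4 by decide)]

/-- The fourth moment of the standard normal law. -/
noncomputable def fourthMoment : ℝ := ∫ x, x ^ 4 ∂(gaussianReal 0 1)

theorem bivariate_mul_sq {ρ : ℝ} (hρ : ρ ∈ Set.Ico (0 : ℝ) 1) :
    Integrable (fun p : ℝ × ℝ => (p.1 * p.2) ^ 2) (bivariate ρ) ∧
      ∫ p, (p.1 * p.2) ^ 2 ∂(bivariate ρ) ≤ fourthMoment := by
  have hfst := measurePreserving_fst_bivariate ρ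
  have hsnd := measurePreserving_snd_bivariate hρ
  have h1 : Integrable (fun p : ℝ × ℝ => p.1 ^ 4) (bivariate ρ) :=
    hfst.integrable_comp_of_integrable integrable_pow_four_gaussian
  have h2 : Integrable (fun p : ℝ × ℝ => p.2 ^ 4) (bivariate ρ) :=
    hsnd.integrable_comp_of_integrable integrable_pow_four_gaussian
  have h3 : Integrable (fun p : ℝ × ℝ => 1 / 2 * p.1 ^ 4 + 1 / 2 * p.2 ^ 4) (bivariate ρ) :=
    (h1.const_mul _).add (h2.const_mul _)
  have hle : ∀ p : ℝ × ℝ, (p.1 * p.2) ^ 2 ≤ 1 / 2 * p.1 ^ 4 + 1 / 2 * p.2 ^ 4 := fun p => by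
    nlinarith [sq_nonneg (p.1 ^ 2 - p.2 ^ 2)]
  have h4 : Integrable (fun p : ℝ × ℝ => (p.1 * p.2) ^ 2) (bivariate ρ) :=
    h3.mono' (Measurable.aestronglyMeasurable (by fun_prop)) (ae_of_all _ fun p => by
      rw [Real.norm_eq_abs, abs_of_nonneg (sq_nonneg _)]; exact hle p)
  refine ⟨h4, (integral_mono h4 h3 hle).trans_eq ?_⟩
  have e1 : ∫ p, p.1 ^ 4 ∂(bivariate ρ) = fourthMoment := by
    rw [fourthMoment, ← hfst.map_eq, integral_map (by fun_prop)
      (Measurable.aestronglyMeasurable (by fun_prop))]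
  have e2 : ∫ p, p.2 ^ 4 ∂(bivariate ρ) = fourthMoment := by
    rw [fourthMoment, ← hsnd.map_eq, integral_map (by fun_prop)
      (Measurable.aestronglyMeasurable (by fun_prop))]
  rw [integral_add (h1.const_mul _) (h2.const_mul _), integral_const_mul, integral_const_mul, e1, e2]
  ring

theorem memLp_mul_bivariate {ρ : ℝ} (hρ : ρ ∈ Set.Ico (0 : ℝ) 1) :
    MemLp (fun p : ℝ × ℝ => p.1 * p.2) 2 (bivariate ρ) :=
  (memLp_two_iff_integrable_sq (Measurable.aestronglyMeasurable (by fun_prop))).2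
    (bivariate_mul_sq hρ).1

theorem integrable_gaussian : Integrable (fun x : ℝ => x) (gaussianReal 0 1) :=
  (memLp_id_gaussianReal (μ := 0) (v := 1) 1).integrable le_rfl

theorem integral_mul_bivariate (ρ : ℝ) : ∫ p, p.1 * p.2 ∂(bivariate ρ) = ρ := by
  have hL : MemLp (fun x : ℝ => x) 2 (gaussianReal 0 1) := memLp_id_gaussianReal 2
  have hsq : ∫ x, x ^ 2 ∂(gaussianReal 0 1) = 1 := by
    have h := variance_id_gaussianReal (μ := 0) (v := 1)
    rw [variance_eq_integral (by fun_prop)] at h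
    simpa [integral_id_gaussianReal] using h
  rw [bivariate, integral_map (by fun_prop) (Measurable.aestronglyMeasurable (by fun_prop))]
  have : ∀ w : ℝ × ℝ, w.1 * (ρ * w.1 + √(1 - ρ ^ 2) * w.2) =
      ρ * w.1 ^ 2 + √(1 - ρ ^ 2) * (w.1 * w.2) := fun w => by ring
  simp_rw [this]
  rw [integral_add ((hL.integrable_sq.comp_fst _).const_mul _)
    ((integrable_gaussian.mul_prod integrable_gaussian).const_mul _), integral_const_mul,
    integral_const_mul, integral_prod_mul (fun x : ℝ => x) fun x : ℝ => x, integral_id_gaussianReal,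
    integral_fun_fst (f := fun x : ℝ => x ^ 2), hsq]
  simp

/-- The inner product, as a function of a pair of vectors. -/
def dotKernel (d : ℕ) (p : (Fin d → ℝ) × (Fin d → ℝ)) : ℝ := ∑ j, p.1 j * p.2 j

@[fun_prop]
theorem measurable_dotKernel (d : ℕ) : Measurable (dotKernel d) := by
  unfold dotKernel; fun_prop

theorem measurePreserving_unzip_gaussianPair {ρ : ℝ} (hρ : ρ ∈ Set.Ico (0 : ℝ) 1) (d : ℕ) :
    MeasurePreserving (unzipAlong (Function.Embedding.refl (Fin d)))
      (Measure.pi fun _ : Fin d => bivariate ρ) (gaussianPair d ρ) :=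
  ⟨by fun_prop, (gaussianPair_eq_map hρ d).symm⟩

theorem memLp_dot_pi {ρ : ℝ} (hρ : ρ ∈ Set.Ico (0 : ℝ) 1) (d : ℕ) :
    MemLp (fun z : Fin d → ℝ × ℝ => ∑ j, (z j).1 * (z j).2) 2
      (Measure.pi fun _ : Fin d => bivariate ρ) :=
  memLp_finsetSum _ fun j _ => (memLp_mul_bivariate hρ).comp_measurePreserving
    (measurePreserving_eval (fun _ : Fin d => bivariate ρ) j)

theorem memLp_dotKernel {ρ : ℝ} (hρ : ρ ∈ Set.Ico (0 : ℝ) 1) (d : ℕ) :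
    MemLp (dotKernel d) 2 (gaussianPair d ρ) := by
  rw [← (measurePreserving_unzip_gaussianPair hρ d).map_eq,
    memLp_map_measure_iff (by fun_prop) (by fun_prop)]
  exact memLp_dot_pi hρ d

theorem integral_dotKernel {ρ : ℝ} (hρ : ρ ∈ Set.Ico (0 : ℝ) 1) (d : ℕ) :
    ∫ p, dotKernel d p ∂(gaussianPair d ρ) = d * ρ := by
  rw [← (measurePreserving_unzip_gaussianPair hρ d).map_eq, integral_map (by fun_prop)
    (measurable_dotKernel d).aestronglyMeasurable]
  simp only [dotKernel, unzipAlong, Function.Embedding.refl_apply]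
  rw [integral_finsetSum]
  · have : ∀ j : Fin d, ∫ z, (z j).1 * (z j).2 ∂(Measure.pi fun _ : Fin d => bivariate ρ) = ρ := by
      intro j
      have := integral_comp_eval (μ := fun _ : Fin d => bivariate ρ) (i := j)
        (f := fun p : ℝ × ℝ => p.1 * p.2) (Measurable.aestronglyMeasurable (by fun_prop))
      rw [this, integral_mul_bivariate]
    simp [this]
  · exact fun j _ => integrable_comp_eval (μ := fun _ : Fin d => bivariate ρ)
      ((memLp_mul_bivariate hρ).integrable one_le_two)

/-- The variance is additive over independent coordinates, each contributing at most the fourth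
moment; the last term is the squared mean. -/
theorem integral_dotKernel_sq_le {ρ : ℝ} (hρ : ρ ∈ Set.Ico (0 : ℝ) 1) (d : ℕ) :
    ∫ p, dotKernel d p ^ 2 ∂(gaussianPair d ρ) ≤ d * fourthMoment + (d * ρ) ^ 2 := by
  have hmp := measurePreserving_unzip_gaussianPair hρ d
  have hmean := integral_dotKernel hρ d
  rw [← hmp.map_eq, integral_map (by fun_prop)
    (measurable_dotKernel d).aestronglyMeasurable] at hmean
  rw [← hmp.map_eq, integral_map (by fun_prop)
    ((measurable_dotKernel d).pow_const 2).aestronglyMeasurable]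
  have hvar := variance_sum_pi (μ := fun _ : Fin d => bivariate ρ)
    (X := fun _ p => p.1 * p.2) fun _ => memLp_mul_bivariate hρ
  have hL := memLp_dot_pi hρ d
  have hfun : (∑ j, fun z : Fin d → ℝ × ℝ => (z j).1 * (z j).2) =
      fun z : Fin d → ℝ × ℝ => ∑ j, (z j).1 * (z j).2 := by
    ext z; simp
  rw [hfun, variance_eq_sub hL] at hvar
  have hle : ∑ _j : Fin d, Var[fun p : ℝ × ℝ => p.1 * p.2; bivariate ρ] ≤ d * fourthMoment := by
    refine (Finset.sum_le_sum (g := fun _ => fourthMoment) fun j _ => ?_).trans_eq (by simp)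
    exact (variance_le_expectation_sq (memLp_mul_bivariate hρ).aestronglyMeasurable).trans
      (bivariate_mul_sq hρ).2
  have e1 : ∫ z, dotKernel d (unzipAlong (Function.Embedding.refl (Fin d)) z) ^ 2
      ∂(Measure.pi fun _ : Fin d => bivariate ρ) =
      ∫ z, ((fun z : Fin d → ℝ × ℝ => ∑ j, (z j).1 * (z j).2) ^ 2) z
        ∂(Measure.pi fun _ : Fin d => bivariate ρ) := rfl
  have e2 : ∫ z, ∑ j, (z j).1 * (z j).2 ∂(Measure.pi fun _ : Fin d => bivariate ρ) = d * ρ := hmean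
  rw [e1]
  rw [e2] at hvar
  linarith

theorem fst_prod_snd_gaussianPair {ρ : ℝ} (hρ : ρ ∈ Set.Ico (0 : ℝ) 1) (d : ℕ) :
    (gaussianPair d ρ).fst.prod (gaussianPair d ρ).snd = gaussianPair d 0 := by
  rw [fst_gaussianPair hρ, snd_gaussianPair hρ, gaussianPair_zero]

theorem isDegenerateKernel_dotKernel {ρ : ℝ} (hρ : ρ ∈ Set.Ico (0 : ℝ) 1) (d : ℕ) :
    IsDegenerateKernel (gaussianPair d ρ) (dotKernel d) where
  measurable := measurable_dotKernel d
  memLp := memLp_dotKernel hρ d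
  memLp_prod := by
    rw [fst_prod_snd_gaussianPair hρ]; exact memLp_dotKernel (by simp) d
  integral_fst y := by
    rw [fst_gaussianPair hρ]
    simp only [dotKernel]
    have hi : ∀ j : Fin d, Integrable (fun x : Fin d → ℝ => x j) (stdNormal d) := fun j =>
      integrable_comp_eval (μ := fun _ : Fin d => gaussianReal 0 1) integrable_gaussian
    rw [integral_finsetSum _ fun j _ => (hi j).mul_const _]
    refine Finset.sum_eq_zero fun j _ => ?_
    rw [integral_mul_const, integral_comp_eval (μ := fun _ : Fin d => gaussianReal 0 1)
      (f := fun x : ℝ => x) (by fun_prop), integral_id_gaussianReal, zero_mul]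
  integral_snd x := by
    rw [snd_gaussianPair hρ]
    simp only [dotKernel]
    have hi : ∀ j : Fin d, Integrable (fun x : Fin d → ℝ => x j) (stdNormal d) := fun j =>
      integrable_comp_eval (μ := fun _ : Fin d => gaussianReal 0 1) integrable_gaussian
    rw [integral_finsetSum _ fun j _ => (hi j).const_mul _]
    refine Finset.sum_eq_zero fun j _ => ?_
    rw [integral_const_mul, integral_comp_eval (μ := fun _ : Fin d => gaussianReal 0 1)
      (f := fun x : ℝ => x) (by fun_prop), integral_id_gaussianReal, mul_zero]

end Dot

/-! ### Detection in growing dimension. -/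

section Growing

variable {α : ℝ} {m : ℕ → ℕ}

theorem tendsto_sampleSize (hα : 0 < α)
    (hm : Tendsto (fun n : ℕ => (m n : ℝ) / (n : ℝ)) atTop (𝓝 α)) :
    Tendsto (fun n => (m n : ℝ)) atTop atTop := by
  refine (hm.pos_mul_atTop hα tendsto_natCast_atTop_atTop).congr' ?_
  filter_upwards [eventually_gt_atTop 0] with n hn
  have : (n : ℝ) ≠ 0 := by positivity
  field_simp

theorem tendsto_inv_ratio (hα : 0 < α)
    (hm : Tendsto (fun n : ℕ => (m n : ℝ) / (n : ℝ)) atTop (𝓝 α)) :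
    Tendsto (fun n : ℕ => (n : ℝ) / (m n : ℝ)) atTop (𝓝 α⁻¹) := by
  simpa using hm.inv₀ hα.ne'

/-- The mean is `d ρ` and the null second moment is at most a constant times `d`, so the
noise-to-signal ratio is of order `1 / (ρ² d)`. The diagonal fluctuations vanish because the sample
size `m` tends to infinity. -/
theorem strongDetection_of_tendsto_atTop (hα : 0 < α) (hmn : ∀ n, m n ≤ n)
    (hm : Tendsto (fun n : ℕ => (m n : ℝ) / (n : ℝ)) atTop (𝓝 α))
    {ρ : ℕ → ℝ} (hρ : ∀ n, ρ n ∈ Set.Ioo (0 : ℝ) 1) {d : ℕ → ℕ}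
    (h : Tendsto (fun n => ρ n ^ 2 * (d n : ℝ)) atTop atTop) :
    StrongDetection (fun n => nullLaw (gaussianPair (d n) (ρ n)) n (m n))
      (fun n => plantedLaw (gaussianPair (d n) (ρ n)) n (m n)) := by
  have hm1 := tendsto_sampleSize hα hm
  have hm2 := tendsto_inv_ratio hα hm
  set C := fourthMoment
  have hlim : Tendsto (fun n => (8 * (C * (ρ n ^ 2 * (d n : ℝ))⁻¹ + 1)) * (m n : ℝ)⁻¹ +
      24 * (n / m n) * (C * (ρ n ^ 2 * (d n : ℝ))⁻¹)) atTop (𝓝 0) := by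
    have h1 := (h.inv_tendsto_atTop.const_mul C)
    have h2 := hm1.inv_tendsto_atTop
    have := (((h1.add_const 1).const_mul 8).mul h2).add ((hm2.const_mul 24).mul h1)
    simpa using this
  refine strongDetection_of_forall_eps fun ε hε => ?_
  filter_upwards [hlim.eventually_lt_const hε, hm1.eventually_gt_atTop 0,
    h.eventually_gt_atTop 0] with n hn hmpos hdpos
  have hρ' : ρ n ∈ Set.Ico (0 : ℝ) 1 := ⟨(hρ n).1.le, (hρ n).2⟩
  have hρ0 := (hρ n).1
  have hd : 0 < (d n : ℝ) := pos_of_mul_pos_right hdpos (sq_nonneg _)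
  have := isProbabilityMeasure_gaussianPair hρ' (d n)
  refine (isDegenerateKernel_dotKernel hρ' (d n)).exists_test (hmn n) (by exact_mod_cast hmpos)
    (by rw [integral_dotKernel hρ']; positivity) (le_trans ?_ hn.le)
  rw [integral_dotKernel hρ', fst_prod_snd_gaussianPair hρ']
  have e1 := integral_dotKernel_sq_le hρ' (d n)
  have e2 := integral_dotKernel_sq_le (ρ := 0) (by simp) (d n)
  rw [mul_zero, zero_pow two_ne_zero, add_zero] at e2
  refine add_le_add ?_ ?_
  · calc _ ≤ (8 * (d n * C + (d n * ρ n) ^ 2)) / (m n * (d n * ρ n) ^ 2) := by gcongr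
      _ = _ := by field_simp
  · calc _ ≤ (24 * (n / m n) * (d n * C)) / (d n * ρ n) ^ 2 := by gcongr
      _ = _ := by field_simp

end Growing

/-! ### The binned projection kernel. -/

section Bins

/-- The indicator function of the interval `(k, k + 1)`. -/
noncomputable def binInd (k : ℕ) : ℝ → ℝ := (Set.Ioo (k : ℝ) (k + 1)).indicator 1

/-- The standard normal probability of the interval `(k, k + 1)`. -/
noncomputable def binProb (k : ℕ) : ℝ := (gaussianReal 0 1).real (Set.Ioo (k : ℝ) (k + 1))

@[fun_prop]
theorem measurable_binInd (k : ℕ) : Measurable (binInd k) :=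
  measurable_one.indicator measurableSet_Ioo

theorem binInd_mul_self (k : ℕ) (x : ℝ) : binInd k x * binInd k x = binInd k x := by
  unfold binInd
  by_cases h : x ∈ Set.Ioo (k : ℝ) (k + 1) <;> simp [h]

theorem binInd_mul_of_ne {k l : ℕ} (h : k ≠ l) (x : ℝ) : binInd k x * binInd l x = 0 := by
  unfold binInd
  by_cases h1 : x ∈ Set.Ioo (k : ℝ) (k + 1)
  · by_cases h2 : x ∈ Set.Ioo (l : ℝ) (l + 1)
    · exfalso
      have a : (k : ℝ) < l + 1 := h1.1.trans h2.2
      have b : (l : ℝ) < k + 1 := h2.1.trans h1.2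
      norm_cast at a b
      omega
    · simp [h2]
  · simp [h1]

theorem binInd_mem_Icc (k : ℕ) (x : ℝ) : binInd k x ∈ Set.Icc (0 : ℝ) 1 := by
  unfold binInd
  by_cases h : x ∈ Set.Ioo (k : ℝ) (k + 1) <;> simp [h]

theorem integrable_binInd (k : ℕ) : Integrable (binInd k) (gaussianReal 0 1) :=
  (integrable_const (1 : ℝ)).mono' (measurable_binInd k).aestronglyMeasurable
    (ae_of_all _ fun x => by
      rw [Real.norm_eq_abs, abs_of_nonneg (binInd_mem_Icc k x).1]; exact (binInd_mem_Icc k x).2)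

theorem integral_binInd (k : ℕ) : ∫ x, binInd k x ∂(gaussianReal 0 1) = binProb k := by
  unfold binInd binProb
  exact integral_indicator_one measurableSet_Ioo

theorem binProb_pos (k : ℕ) : 0 < binProb k := by
  refine ENNReal.toReal_pos (fun h => ?_) (measure_ne_top _ _)
  have := gaussianReal_absolutelyContinuous' 0 (one_ne_zero : (1 : NNReal) ≠ 0) h
  simp at this

theorem sum_sq_of_mul_eq_zero {ι : Type*} (s : Finset ι) (f : ι → ℝ)
    (h : ∀ i ∈ s, ∀ j ∈ s, i ≠ j → f i * f j = 0) : (∑ i ∈ s, f i) ^ 2 = ∑ i ∈ s, f i ^ 2 := by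
  classical
  rw [sq, Finset.sum_mul_sum]
  refine Finset.sum_congr rfl fun i hi => ?_
  rw [Finset.sum_eq_single_of_mem i hi fun j hj hij => h i hi j hj hij.symm, sq]

/-- The indicator function of the union of the first `K` bins. -/
noncomputable def binUnion (K : ℕ) (x : ℝ) : ℝ := ∑ k ∈ Finset.range K, binInd k x

/-- The probability of the union of the first `K` bins. -/
noncomputable def binTotal (K : ℕ) : ℝ := ∑ k ∈ Finset.range K, binProb k

/-- The kernel of the projection onto the span of the first `K` bins. -/
noncomputable def binProj (K : ℕ) (p : ℝ × ℝ) : ℝ :=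
  ∑ k ∈ Finset.range K, binInd k p.1 * binInd k p.2 / binProb k

/-- The kernel `binProj`, centered in each variable. -/
noncomputable def binKernel (K : ℕ) (p : ℝ × ℝ) : ℝ :=
  binProj K p - binUnion K p.1 - binUnion K p.2 + binTotal K

@[fun_prop]
theorem measurable_binUnion (K : ℕ) : Measurable (binUnion K) := by
  unfold binUnion; fun_prop

@[fun_prop]
theorem measurable_binProj (K : ℕ) : Measurable (binProj K) := by
  unfold binProj; fun_prop

@[fun_prop]
theorem measurable_binKernel (K : ℕ) : Measurable (binKernel K) := by
  unfold binKernel; fun_prop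

theorem binUnion_mem_Icc (K : ℕ) (x : ℝ) : binUnion K x ∈ Set.Icc (0 : ℝ) 1 := by
  have h0 : 0 ≤ binUnion K x := Finset.sum_nonneg fun k _ => (binInd_mem_Icc k x).1
  have h1 : binUnion K x ^ 2 = binUnion K x := by
    unfold binUnion
    rw [sum_sq_of_mul_eq_zero _ _ fun k _ l _ hkl => binInd_mul_of_ne hkl x]
    exact Finset.sum_congr rfl fun k _ => by rw [sq, binInd_mul_self]
  -- Disjointness of the bins makes the sum idempotent, hence at most `1`.
  exact ⟨h0, by nlinarith⟩

theorem integrable_binUnion (K : ℕ) : Integrable (binUnion K) (gaussianReal 0 1) :=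
  integrable_finsetSum _ fun k _ => integrable_binInd k

theorem integral_binUnion (K : ℕ) : ∫ x, binUnion K x ∂(gaussianReal 0 1) = binTotal K := by
  unfold binUnion binTotal
  rw [integral_finsetSum _ fun k _ => integrable_binInd k]
  simp only [integral_binInd]

theorem binTotal_mem_Icc (K : ℕ) : binTotal K ∈ Set.Icc (0 : ℝ) 1 := by
  rw [← integral_binUnion]
  refine ⟨integral_nonneg fun x => (binUnion_mem_Icc K x).1, ?_⟩
  refine (integral_mono (integrable_binUnion K) (integrable_const (1 : ℝ))
    fun x => (binUnion_mem_Icc K x).2).trans_eq (by simp)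

theorem binProj_mem_Icc (K : ℕ) (p : ℝ × ℝ) :
    binProj K p ∈ Set.Icc 0 (∑ k ∈ Finset.range K, 1 / binProb k) := by
  have hp := binProb_pos
  refine ⟨Finset.sum_nonneg fun k _ => div_nonneg (mul_nonneg (binInd_mem_Icc k _).1
    (binInd_mem_Icc k _).1) (hp k).le, Finset.sum_le_sum fun k _ => ?_⟩
  have := hp k
  gcongr
  exact mul_le_one₀ (binInd_mem_Icc k _).2 (binInd_mem_Icc k _).1 (binInd_mem_Icc k _).2

/-- A bound for the absolute value of `binKernel`. -/
noncomputable def binBound (K : ℕ) : ℝ := ∑ k ∈ Finset.range K, 1 / binProb k + 2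

theorem abs_binKernel_le (K : ℕ) (p : ℝ × ℝ) : |binKernel K p| ≤ binBound K := by
  have h1 := binProj_mem_Icc K p
  have h2 := binUnion_mem_Icc K p.1
  have h3 := binUnion_mem_Icc K p.2
  have h4 := binTotal_mem_Icc K
  have h5 := h1.1.trans h1.2
  unfold binKernel binBound
  rw [abs_le]
  constructor <;> linarith [h1.1, h1.2, h2.1, h2.2, h3.1, h3.2, h4.1, h4.2]

theorem integrable_binProj (K : ℕ) (P : Measure (ℝ × ℝ)) [IsProbabilityMeasure P] :
    Integrable (binProj K) P :=
  (integrable_const (∑ k ∈ Finset.range K, 1 / binProb k)).mono'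
    (measurable_binProj K).aestronglyMeasurable (ae_of_all _ fun p => by
      rw [Real.norm_eq_abs, abs_of_nonneg (binProj_mem_Icc K p).1]; exact (binProj_mem_Icc K p).2)

theorem memLp_binKernel (K : ℕ) (P : Measure (ℝ × ℝ)) [IsProbabilityMeasure P] :
    MemLp (binKernel K) 2 P :=
  MemLp.of_bound (measurable_binKernel K).aestronglyMeasurable (binBound K)
    (ae_of_all _ fun p => abs_binKernel_le K p)

theorem binKernel_swap (K : ℕ) (x y : ℝ) : binKernel K (x, y) = binKernel K (y, x) := by
  unfold binKernel binProj
  simp only [mul_comm (binInd _ x)]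
  ring

theorem integral_binKernel_snd (K : ℕ) (x : ℝ) :
    ∫ y, binKernel K (x, y) ∂(gaussianReal 0 1) = 0 := by
  have h1 : ∫ y, binProj K (x, y) ∂(gaussianReal 0 1) = binUnion K x := by
    simp only [binProj, binUnion]
    rw [integral_finsetSum _ fun k _ => ((integrable_binInd k).const_mul _).div_const _]
    refine Finset.sum_congr rfl fun k _ => ?_
    rw [integral_div, integral_const_mul, integral_binInd, mul_div_cancel_right₀ _ (binProb_pos k).ne']
  have hi : Integrable (fun y => binProj K (x, y)) (gaussianReal 0 1) := by
    simp only [binProj]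
    exact integrable_finsetSum _ fun k _ => ((integrable_binInd k).const_mul _).div_const _
  have hi1 : Integrable (fun y => binProj K (x, y) - binUnion K x) (gaussianReal 0 1) :=
    hi.sub (integrable_const _)
  have hi2 : Integrable (fun y => binProj K (x, y) - binUnion K x - binUnion K y)
    (gaussianReal 0 1) := hi1.sub (integrable_binUnion K)
  simp only [binKernel]
  rw [integral_add hi2 (integrable_const _), integral_sub hi1 (integrable_binUnion K),
    integral_sub hi (integrable_const _), h1, integral_binUnion]
  simp

theorem integral_binKernel_bivariate (K : ℕ) {ρ : ℝ} (hρ : ρ ∈ Set.Ico (0 : ℝ) 1) :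
    ∫ p, binKernel K p ∂(bivariate ρ) = ∫ p, binProj K p ∂(bivariate ρ) - binTotal K := by
  have hfst := measurePreserving_fst_bivariate ρ
  have hsnd := measurePreserving_snd_bivariate hρ
  have h1 : Integrable (fun p : ℝ × ℝ => binUnion K p.1) (bivariate ρ) :=
    hfst.integrable_comp_of_integrable (integrable_binUnion K)
  have h2 : Integrable (fun p : ℝ × ℝ => binUnion K p.2) (bivariate ρ) :=
    hsnd.integrable_comp_of_integrable (integrable_binUnion K)
  have e1 : ∫ p : ℝ × ℝ, binUnion K p.1 ∂(bivariate ρ) = binTotal K := by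
    rw [← integral_binUnion, ← hfst.map_eq, integral_map (by fun_prop)
      (measurable_binUnion K).aestronglyMeasurable]
  have e2 : ∫ p : ℝ × ℝ, binUnion K p.2 ∂(bivariate ρ) = binTotal K := by
    rw [← integral_binUnion, ← hsnd.map_eq, integral_map (by fun_prop)
      (measurable_binUnion K).aestronglyMeasurable]
  have h0 := integrable_binProj K (bivariate ρ)
  have hi1 : Integrable (fun p => binProj K p - binUnion K p.1) (bivariate ρ) := h0.sub h1
  have hi2 : Integrable (fun p => binProj K p - binUnion K p.1 - binUnion K p.2) (bivariate ρ) :=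
    hi1.sub h2
  simp only [binKernel]
  rw [integral_add hi2 (integrable_const _), integral_sub hi1 h2, integral_sub h0 h1, e1, e2]
  simp

/-- The squared Hilbert–Schmidt norm of a rank `K` projection is `K`; the centering terms are
bounded by `2` in absolute value. -/
theorem integral_binKernel_sq_le (K : ℕ) :
    ∫ p, binKernel K p ^ 2 ∂((gaussianReal 0 1).prod (gaussianReal 0 1)) ≤ 2 * K + 8 := by
  have hsq : ∀ p : ℝ × ℝ, binProj K p ^ 2 =
      ∑ k ∈ Finset.range K, (binInd k p.1 * binInd k p.2) / binProb k ^ 2 := by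
    intro p
    unfold binProj
    rw [sum_sq_of_mul_eq_zero]
    · refine Finset.sum_congr rfl fun k _ => ?_
      rw [div_pow, mul_pow, sq, sq (binInd k p.2), binInd_mul_self, binInd_mul_self]
    · intro k _ l _ hkl
      rw [div_mul_div_comm, mul_mul_mul_comm, binInd_mul_of_ne hkl, zero_mul, zero_div]
  have hi : ∀ k ∈ Finset.range K, Integrable (fun p : ℝ × ℝ =>
      (binInd k p.1 * binInd k p.2) / binProb k ^ 2)
      ((gaussianReal 0 1).prod (gaussianReal 0 1)) := fun k _ =>
    ((integrable_binInd k).mul_prod (integrable_binInd k)).div_const _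
  have hint : Integrable (fun p => binProj K p ^ 2)
      ((gaussianReal 0 1).prod (gaussianReal 0 1)) := by
    simp_rw [hsq]; exact integrable_finsetSum _ hi
  have hproj : ∫ p, binProj K p ^ 2 ∂((gaussianReal 0 1).prod (gaussianReal 0 1)) = K := by
    simp_rw [hsq]
    rw [integral_finsetSum _ hi]
    have : ∀ k ∈ Finset.range K, ∫ p : ℝ × ℝ, (binInd k p.1 * binInd k p.2) / binProb k ^ 2
        ∂((gaussianReal 0 1).prod (gaussianReal 0 1)) = 1 := by
      intro k _
      rw [integral_div, integral_prod_mul (binInd k) (binInd k), integral_binInd]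
      have := (binProb_pos k).ne'
      field_simp
    rw [Finset.sum_congr rfl this]
    simp
  calc _ ≤ ∫ p, (2 * binProj K p ^ 2 + (8 : ℝ)) ∂((gaussianReal 0 1).prod (gaussianReal 0 1)) := by
        refine integral_mono (memLp_binKernel K _).integrable_sq
          ((hint.const_mul 2).add (integrable_const _)) fun p => ?_
        have h2 := binUnion_mem_Icc K p.1
        have h3 := binUnion_mem_Icc K p.2
        have h4 := binTotal_mem_Icc K
        have hc : (binTotal K - binUnion K p.1 - binUnion K p.2) ^ 2 ≤ 2 ^ 2 :=
          sq_le_sq' (by linarith [h2.1, h2.2, h3.1, h3.2, h4.1, h4.2])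
            (by linarith [h2.1, h2.2, h3.1, h3.2, h4.1, h4.2])
        simp only [binKernel]
        nlinarith [sq_nonneg (binProj K p - (binTotal K - binUnion K p.1 - binUnion K p.2))]
    _ = 2 * (K : ℝ) + 8 := by
        rw [integral_add (hint.const_mul 2) (integrable_const _), integral_const_mul, hproj]
        simp

/-- As `ρ → 1` the second coordinate converges to the first, so the mean converges to the integral
of the kernel on the diagonal, which is the trace `K`. -/
theorem tendsto_integral_binProj (K : ℕ) {ρ : ℕ → ℝ} (hρ : Tendsto ρ atTop (𝓝 1)) :
    Tendsto (fun n => ∫ p, binProj K p ∂(bivariate (ρ n))) atTop (𝓝 K) := by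
  have hlim : ∫ w : ℝ × ℝ, binProj K (w.1, w.1) ∂((gaussianReal 0 1).prod (gaussianReal 0 1)) =
      K := by
    unfold binProj
    simp only [binInd_mul_self]
    rw [integral_finsetSum _ fun k _ => ((integrable_binInd k).comp_fst _).div_const _]
    have : ∀ k ∈ Finset.range K, ∫ w : ℝ × ℝ, binInd k w.1 / binProb k
        ∂((gaussianReal 0 1).prod (gaussianReal 0 1)) = 1 := by
      intro k _
      rw [integral_div, integral_fun_fst (f := binInd k), integral_binInd]
      simp [(binProb_pos k).ne']
    rw [Finset.sum_congr rfl this]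
    simp
  have heq : ∀ n, ∫ p, binProj K p ∂(bivariate (ρ n)) =
      ∫ w : ℝ × ℝ, binProj K (w.1, ρ n * w.1 + √(1 - ρ n ^ 2) * w.2)
        ∂((gaussianReal 0 1).prod (gaussianReal 0 1)) := fun n => by
    rw [bivariate, integral_map (by fun_prop) (measurable_binProj K).aestronglyMeasurable]
  simp_rw [heq]
  rw [← hlim]
  refine tendsto_integral_of_dominated_convergence
    (fun _ => ∑ k ∈ Finset.range K, 1 / binProb k)
    (fun n => (Measurable.aestronglyMeasurable (by fun_prop))) (integrable_const _)
    (fun n => ae_of_all _ fun w => ?_) (ae_of_all _ fun w => ?_)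
  · rw [Real.norm_eq_abs, abs_of_nonneg (binProj_mem_Icc K _).1]
    exact (binProj_mem_Icc K _).2
  · have hy : Tendsto (fun n => ρ n * w.1 + √(1 - ρ n ^ 2) * w.2) atTop (𝓝 w.1) := by
      have h1 : Tendsto (fun n => √(1 - ρ n ^ 2)) atTop (𝓝 0) := by
        simpa using ((hρ.pow 2).const_sub 1).sqrt
      simpa using (hρ.mul_const w.1).add (h1.mul_const w.2)
    unfold binProj
    refine tendsto_finsetSum _ fun k _ => Tendsto.div_const ?_ _
    -- Bin endpoints cause no trouble: inside an open bin the perturbed point eventually stays in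
    -- it, and otherwise the factor at `w.1` already vanishes.
    by_cases hw : w.1 ∈ Set.Ioo (k : ℝ) (k + 1)
    · refine tendsto_const_nhds.congr' ?_
      filter_upwards [hy.eventually (isOpen_Ioo.mem_nhds hw)] with n hn
      have hn' : ρ n * w.1 + √(1 - ρ n ^ 2) * w.2 ∈ Set.Ioo (k : ℝ) (k + 1) := hn
      simp only [binInd, Set.indicator_of_mem hw, Set.indicator_of_mem hn', Pi.one_apply]
    · simp [binInd, hw]

end Bins

/-! ### Both directions in fixed dimension. -/

section FixedDimension

theorem measurePreserving_coord_gaussianPair {ρ : ℝ} (hρ : ρ ∈ Set.Ico (0 : ℝ) 1) {d : ℕ}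
    (i : Fin d) :
    MeasurePreserving (fun p : (Fin d → ℝ) × (Fin d → ℝ) => (p.1 i, p.2 i)) (gaussianPair d ρ)
      (bivariate ρ) := by
  refine ⟨by fun_prop, ?_⟩
  rw [gaussianPair_eq_map hρ, Measure.map_map (by fun_prop) (by fun_prop)]
  exact (measurePreserving_eval (fun _ : Fin d => bivariate ρ) i).map_eq

theorem isDegenerateKernel_binKernel (K : ℕ) {ρ : ℝ} (hρ : ρ ∈ Set.Ico (0 : ℝ) 1) {d : ℕ}
    (i : Fin d) :
    IsDegenerateKernel (gaussianPair d ρ) fun p => binKernel K (p.1 i, p.2 i) where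
  measurable := by fun_prop
  memLp := (memLp_binKernel K _).comp_measurePreserving (measurePreserving_coord_gaussianPair hρ i)
  memLp_prod := by
    rw [fst_prod_snd_gaussianPair hρ]
    exact (memLp_binKernel K _).comp_measurePreserving
      (measurePreserving_coord_gaussianPair (by simp) i)
  integral_fst y := by
    rw [fst_gaussianPair hρ]
    rw [integral_comp_eval (μ := fun _ : Fin d => gaussianReal 0 1) (i := i)
      (f := fun x => binKernel K (x, y i)) (Measurable.aestronglyMeasurable (by fun_prop))]
    simp_rw [binKernel_swap K _ (y i)]
    exact integral_binKernel_snd K (y i)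
  integral_snd x := by
    rw [snd_gaussianPair hρ]
    rw [integral_comp_eval (μ := fun _ : Fin d => gaussianReal 0 1) (i := i)
      (f := fun y => binKernel K (x i, y)) (Measurable.aestronglyMeasurable (by fun_prop))]
    exact integral_binKernel_snd K (x i)

/-- One coordinate suffices. The number `K` of bins is fixed by `ε` before `n` grows, so the bound
on the kernel, which depends on `K`, is harmless once divided by `m`. -/
theorem strongDetection_of_tendsto_one {α : ℝ} {m : ℕ → ℕ} (hα : 0 < α) (hmn : ∀ n, m n ≤ n)
    (hm : Tendsto (fun n : ℕ => (m n : ℝ) / (n : ℝ)) atTop (𝓝 α))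
    {ρ : ℕ → ℝ} (hρ : ∀ n, ρ n ∈ Set.Ioo (0 : ℝ) 1) {d : ℕ} (hd : 1 ≤ d)
    (h : Tendsto (fun n => ρ n ^ 2) atTop (𝓝 1)) :
    StrongDetection (fun n => nullLaw (gaussianPair d (ρ n)) n (m n))
      (fun n => plantedLaw (gaussianPair d (ρ n)) n (m n)) := by
  have hm1 := tendsto_sampleSize hα hm
  have hm2 := tendsto_inv_ratio hα hm
  have hρ1 : Tendsto ρ atTop (𝓝 1) := by
    have := h.sqrt
    rw [Real.sqrt_one] at this
    exact this.congr fun n => Real.sqrt_sq (hρ n).1.le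
  let i : Fin d := ⟨0, hd⟩
  refine strongDetection_of_forall_eps fun ε hε => ?_
  -- The noise term is at most `24 · (2 / α) · 10 K / (K / 2)² = 1920 / (α K)`, to be made at most
  -- `ε / 2`. The bound `4` leaves room for `K / 2 + 1 < K` and `2 K + 8 ≤ 10 K`.
  obtain ⟨K, hK⟩ := exists_nat_gt (max 4 (1920 * α⁻¹ / ε * 2))
  have hK4 : (4 : ℝ) < K := (le_max_left _ _).trans_lt hK
  have hKε : 1920 * α⁻¹ / ε * 2 < K := (le_max_right _ _).trans_lt hK
  have hK0 : (0 : ℝ) < K := by linarith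
  have hlim1 : Tendsto (fun n => 8 * binBound K ^ 2 / (m n * ((K : ℝ) / 2) ^ 2)) atTop (𝓝 0) :=
    tendsto_const_nhds.div_atTop (hm1.atTop_mul_const (by positivity))
  have hα' : α⁻¹ < 2 * α⁻¹ := by have := inv_pos.2 hα; linarith
  filter_upwards [hlim1.eventually_lt_const (half_pos hε), hm2.eventually_lt_const hα',
    (tendsto_integral_binProj K hρ1).eventually_const_lt (show (K : ℝ) / 2 + 1 < K by linarith),
    hm1.eventually_gt_atTop 0] with n h1 h2 h3 h4
  have hρ' : ρ n ∈ Set.Ico (0 : ℝ) 1 := ⟨(hρ n).1.le, (hρ n).2⟩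
  have := isProbabilityMeasure_gaussianPair hρ' d
  have hmp := measurePreserving_coord_gaussianPair hρ' i
  have hmp0 := measurePreserving_coord_gaussianPair (ρ := 0) (by simp) i
  have hmean : (K : ℝ) / 2 ≤ ∫ p, binKernel K (p.1 i, p.2 i) ∂(gaussianPair d (ρ n)) := by
    rw [← integral_map (φ := fun p : (Fin d → ℝ) × (Fin d → ℝ) => (p.1 i, p.2 i))
      (by fun_prop) (measurable_binKernel K).aestronglyMeasurable, hmp.map_eq,
      integral_binKernel_bivariate K hρ']
    have := (binTotal_mem_Icc K).2
    linarith
  have hsq : ∫ p, binKernel K (p.1 i, p.2 i) ^ 2 ∂(gaussianPair d (ρ n)) ≤ binBound K ^ 2 := by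
    have hL := (isDegenerateKernel_binKernel K hρ' i).memLp.integrable_sq
    refine (integral_mono hL (integrable_const (binBound K ^ 2)) fun p => ?_).trans_eq (by simp)
    exact sq_le_sq' (abs_le.1 (abs_binKernel_le K _)).1 (abs_le.1 (abs_binKernel_le K _)).2
  have hsq0 : ∫ p, binKernel K (p.1 i, p.2 i) ^ 2
      ∂((gaussianPair d (ρ n)).fst.prod (gaussianPair d (ρ n)).snd) ≤ 2 * K + 8 := by
    rw [fst_prod_snd_gaussianPair hρ',
      ← integral_map (φ := fun p : (Fin d → ℝ) × (Fin d → ℝ) => (p.1 i, p.2 i))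
      (f := fun q => binKernel K q ^ 2) (by fun_prop)
      ((measurable_binKernel K).pow_const 2).aestronglyMeasurable, hmp0.map_eq, bivariate_zero]
    exact integral_binKernel_sq_le K
  refine (isDegenerateKernel_binKernel K hρ' i).exists_test (hmn n) (by exact_mod_cast h4)
    (by linarith) ?_
  have hpos : 0 < ∫ p, binKernel K (p.1 i, p.2 i) ∂(gaussianPair d (ρ n)) := by linarith
  have hA : (8 * ∫ p, binKernel K (p.1 i, p.2 i) ^ 2 ∂(gaussianPair d (ρ n))) /
      (m n * (∫ p, binKernel K (p.1 i, p.2 i) ∂(gaussianPair d (ρ n))) ^ 2) ≤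
      8 * binBound K ^ 2 / (m n * ((K : ℝ) / 2) ^ 2) := by
    gcongr
  have hB : (24 * (n / m n) * ∫ p, binKernel K (p.1 i, p.2 i) ^ 2
      ∂((gaussianPair d (ρ n)).fst.prod (gaussianPair d (ρ n)).snd)) /
      (∫ p, binKernel K (p.1 i, p.2 i) ∂(gaussianPair d (ρ n))) ^ 2 ≤
      (24 * (2 * α⁻¹) * (10 * K)) / ((K : ℝ) / 2) ^ 2 := by
    have h5 : ∫ p, binKernel K (p.1 i, p.2 i) ^ 2
      ∂((gaussianPair d (ρ n)).fst.prod (gaussianPair d (ρ n)).snd) ≤ 10 * K :=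
      hsq0.trans (by linarith)
    have : 0 ≤ ∫ p, binKernel K (p.1 i, p.2 i) ^ 2
      ∂((gaussianPair d (ρ n)).fst.prod (gaussianPair d (ρ n)).snd) :=
      integral_nonneg fun _ => sq_nonneg _
    gcongr
  have hC : (24 * (2 * α⁻¹) * (10 * K)) / ((K : ℝ) / 2) ^ 2 ≤ ε / 2 := by
    have e : (24 * (2 * α⁻¹) * (10 * K)) / ((K : ℝ) / 2) ^ 2 = 1920 * α⁻¹ / K := by
      field_simp
      ring
    rw [e, div_le_iff₀ hK0]
    have : 1920 * α⁻¹ * 2 < K * ε := by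
      rw [div_mul_eq_mul_div, div_lt_iff₀ hε] at hKε
      exact hKε
    linarith
  linarith

theorem tendsto_one_of_strongDetection {m : ℕ → ℕ} (hmn : ∀ n, m n ≤ n)
    {ρ : ℕ → ℝ} (hρ : ∀ n, ρ n ∈ Set.Ioo (0 : ℝ) 1) {d : ℕ}
    (h : StrongDetection (fun n => nullLaw (gaussianPair d (ρ n)) n (m n))
      (fun n => plantedLaw (gaussianPair d (ρ n)) n (m n))) :
    Tendsto (fun n => ρ n ^ 2) atTop (𝓝 1) := by
  by_contra hnot
  have hlt : ∀ n, ρ n ^ 2 < 1 := fun n => pow_lt_one₀ (hρ n).1.le (hρ n).2 two_ne_zero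
  obtain ⟨a, ha1, ha⟩ : ∃ a < (1 : ℝ), ∃ᶠ n in atTop, ρ n ^ 2 ≤ a := by
    by_contra! hcon
    refine hnot (tendsto_order.2 ⟨fun a ha => ?_, fun a ha =>
      Eventually.of_forall fun n => (hlt n).trans ha⟩)
    exact hcon a ha
  have hr : max a 0 ∈ Set.Ico (0 : ℝ) 1 := ⟨le_max_right _ _, max_lt ha1 one_pos⟩
  have hr1 : 0 < 1 - max a 0 := by linarith [hr.2]
  refine not_strongDetection_of_frequently (S := (1 - max a 0)⁻¹ ^ d) (d := fun _ => d) hr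
    (by positivity) hmn hρ (ha.mono fun n hn => ⟨hn.trans (le_max_left _ _), ?_⟩) h
  have h1 : ρ n ^ 2 ≤ max a 0 := hn.trans (le_max_left _ _)
  have h2 : (1 - ρ n ^ 2)⁻¹ ^ d ≤ (1 - max a 0)⁻¹ ^ d := by
    have : 0 < 1 - ρ n ^ 2 := by linarith [hlt n]
    gcongr
  linarith

end FixedDimension

/-- If `ρ² d ≤ C` infinitely often, then `ρ²` is small there because `d → ∞`, and `(1 - ρ²)⁻ᵈ` is at
most `exp (2 C)`. -/
theorem tendsto_atTop_of_strongDetection {m : ℕ → ℕ} (hmn : ∀ n, m n ≤ n)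
    {ρ : ℕ → ℝ} (hρ : ∀ n, ρ n ∈ Set.Ioo (0 : ℝ) 1) {d : ℕ → ℕ} (hd : Tendsto d atTop atTop)
    (h : StrongDetection (fun n => nullLaw (gaussianPair (d n) (ρ n)) n (m n))
      (fun n => plantedLaw (gaussianPair (d n) (ρ n)) n (m n))) :
    Tendsto (fun n => ρ n ^ 2 * (d n : ℝ)) atTop atTop := by
  by_contra hnot
  obtain ⟨C, hC⟩ : ∃ C : ℝ, ∃ᶠ n in atTop, ρ n ^ 2 * (d n : ℝ) ≤ C := by
    by_contra! hcon
    exact hnot (tendsto_atTop.2 fun C => (hcon C).mono fun n hn => hn.le)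
  -- The bound `2 C ≤ d` forces `ρ² ≤ 1/2`, the range in which `(1 - x)⁻¹ ≤ 1 + 2 x ≤ exp (2 x)` is
  -- used.
  have hd' : ∀ᶠ n in atTop, max 1 (2 * C) ≤ (d n : ℝ) :=
    (tendsto_natCast_atTop_atTop.comp hd).eventually_ge_atTop _
  refine not_strongDetection_of_frequently (r := 1 / 2) (S := Real.exp (2 * C)) (d := d)
    (by norm_num) (Real.exp_pos _).le hmn hρ ((hC.and_eventually hd').mono fun n hn => ?_) h
  obtain ⟨h1, h2⟩ := hn
  have hd1 : (1 : ℝ) ≤ d n := (le_max_left _ _).trans h2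
  have hd2 : 2 * C ≤ d n := (le_max_right _ _).trans h2
  have hr : ρ n ^ 2 ≤ 1 / 2 := by
    by_contra! hcon
    nlinarith
  refine ⟨hr, ?_⟩
  have hinv : (1 - ρ n ^ 2)⁻¹ ≤ Real.exp (2 * ρ n ^ 2) := by
    have hpos : 0 < 1 - ρ n ^ 2 := by linarith
    refine le_trans ?_ (Real.add_one_le_exp _)
    rw [inv_le_iff_one_le_mul₀ hpos]
    nlinarith [sq_nonneg (ρ n)]
  have hpow : (1 - ρ n ^ 2)⁻¹ ^ d n ≤ Real.exp (2 * C) := by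
    have hpos : 0 < 1 - ρ n ^ 2 := by linarith
    calc (1 - ρ n ^ 2)⁻¹ ^ d n ≤ Real.exp (2 * ρ n ^ 2) ^ d n := by gcongr
      _ = Real.exp (2 * (ρ n ^ 2 * d n)) := by rw [← Real.exp_nat_mul]; ring_nf
      _ ≤ _ := by gcongr
  linarith

end BrokenSample

theorem mainTheorem4 (α : ℝ) (hα : α ∈ Set.Ioc (0 : ℝ) 1)
    (m : ℕ → ℕ) (hmn : ∀ n, m n ≤ n)
    (hm : Tendsto (fun n : ℕ => (m n : ℝ) / (n : ℝ)) atTop (𝓝 α))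
    (ρ : ℕ → ℝ) (hρ : ∀ n, ρ n ∈ Set.Ioo (0 : ℝ) 1) :
    (∀ d : ℕ, 1 ≤ d →
      (BrokenSample.StrongDetection
          (fun n => BrokenSample.nullLaw (BrokenSample.gaussianPair d (ρ n)) n (m n))
          (fun n => BrokenSample.plantedLaw (BrokenSample.gaussianPair d (ρ n)) n (m n)) ↔
        Tendsto (fun n => ρ n ^ 2) atTop (𝓝 1))) ∧
    (∀ d : ℕ → ℕ, Tendsto d atTop atTop →
      (BrokenSample.StrongDetection
          (fun n => BrokenSample.nullLaw (BrokenSample.gaussianPair (d n) (ρ n)) n (m n))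
          (fun n => BrokenSample.plantedLaw (BrokenSample.gaussianPair (d n) (ρ n)) n (m n)) ↔
        Tendsto (fun n => ρ n ^ 2 * (d n : ℝ)) atTop atTop)) := by
  exact ⟨fun d hd => ⟨BrokenSample.tendsto_one_of_strongDetection hmn hρ,
      BrokenSample.strongDetection_of_tendsto_one hα.1 hmn hm hρ hd⟩,
    fun d hd => ⟨BrokenSample.tendsto_atTop_of_strongDetection hmn hρ hd,
      BrokenSample.strongDetection_of_tendsto_atTop hα.1 hmn hm hρ⟩⟩
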